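/- For a Boolean function $f:\{0,1\}^n\to\{0,1\}$ let $\hat f(a)=2^{-n}\sum_{x\in\{0,1\}^n}(-1)^{f(x)\oplus a\cdot x}$ be its Walsh--Hadamard coefficients, $\hat f_{\max}=\max_a|\hat f(a)|$, and $\eta_f=\tfrac12-\tfrac12\hat f_{\max}$ its non-linearity. There is a universal constant $C>0$ such that for every $n\ge 0$, every accuracy parameter $\lambda\in(0,1)$ and every error parameter $\delta\in(0,1)$ there is a quantum query algorithm (which depends on $n,\lambda,\delta$ only, accesses $f$ through the oracle $|x,b\rangle\mapsto|x,b\oplus f(x)\rangle$, may apply arbitrary oracle-independent unitaries on a finite-dimensional space and adapt to intermediate measurements, and always halts) with the following property. For every $f:\{0,1\}^n\to\{0,1\}$, with probability at least $1-\delta$ the algorithm returns an estimate $\tilde\eta_f$ with $|\eta_f-\tilde\eta_f|\le\lambda$ and makes at most $$C\cdot\frac{1}{\lambda\,\hat f_{\max}}\,\log\!\Big(\frac1\lambda\Big)\,\log\!\Big(\frac{1}{\delta\,\hat f_{\max}}\Big)$$ queries to the oracle of $f$. -/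

import Mathlib

/-- The bit strings `{0,1}^n`. -/
abbrev BitString (n : ℕ) : Type := Fin n → Bool

/-- The Walsh-Hadamard coefficient `2^{-n} ∑_x (-1)^{f(x) ⊕ a·x}` of `f` at `a`. -/
noncomputable def walshCoeff {n : ℕ} (f : BitString n → Bool) (a : BitString n) : ℝ :=
  (1 / 2 ^ n) * ∑ x : BitString n, (-1) ^ ((f x).toNat + ∑ i, (a i && x i).toNat)

/-- The largest absolute value of a Walsh-Hadamard coefficient of `f`. -/
noncomputable def walshMax {n : ℕ} (f : BitString n → Bool) : ℝ :=
  Finset.univ.sup' Finset.univ_nonempty fun a : BitString n => |walshCoeff f a|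

/-- The non-linearity of `f`. -/
noncomputable def nonlinearity {n : ℕ} (f : BitString n → Bool) : ℝ :=
  1 / 2 - 1 / 2 * walshMax f

/-- Labels of the standard basis states `|x, b, w⟩`: the `n`-qubit query register, the answer
qubit, and a workspace register whose basis states are the elements of `W`. -/
abbrev BasisLabel (n : ℕ) (W : Type) : Type := BitString n × Bool × W

/-- A state vector (not necessarily normalised), given by its amplitudes. -/
abbrev StateVec (n : ℕ) (W : Type) : Type := BasisLabel n W → ℂ

/-- The standard basis vector `|l⟩`. -/
def StateVec.basis {n : ℕ} {W : Type} [DecidableEq W] (l : BasisLabel n W) : StateVec n W :=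
  fun k => if k = l then 1 else 0

/-- The squared norm of a state vector. -/
noncomputable def StateVec.normSq {n : ℕ} {W : Type} [Fintype W] (ψ : StateVec n W) : ℝ :=
  ∑ l, ‖ψ l‖ ^ 2

/-- The query operator of `f`: the linear map `|x, b, w⟩ ↦ |x, b ⊕ f(x), w⟩`. As this permutation
of the basis is an involution, the new amplitude at `(x, b, w)` is the old one at
`(x, b ⊕ f(x), w)`. -/
def StateVec.query {n : ℕ} {W : Type} (f : BitString n → Bool) (ψ : StateVec n W) :
    StateVec n W :=
  fun l => ψ (l.1, xor l.2.1 (f l.1), l.2.2)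

/-- The orthogonal projection onto the span of the basis states `l` with `g l = i`. -/
def StateVec.project {n : ℕ} {W : Type} {k : ℕ} (g : BasisLabel n W → Fin k) (i : Fin k)
    (ψ : StateVec n W) : StateVec n W :=
  fun l => if g l = i then ψ l else 0

/-- Adaptive quantum query programs. A program either halts with a real number, or applies a
unitary that does not depend on the oracle, or queries the oracle once, or measures the value
`g l` of the basis label in the standard basis and lets the outcome choose how to go on.
Every program is a finite tree, so it always halts. -/
inductive QueryProgram (n : ℕ) (W : Type) [Fintype W] [DecidableEq W] : Type
  | output (r : ℝ) : QueryProgram n W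
  | unitary (U : Matrix.unitaryGroup (BasisLabel n W) ℂ) (next : QueryProgram n W) :
      QueryProgram n W
  | query (next : QueryProgram n W) : QueryProgram n W
  | measure (k : ℕ) (g : BasisLabel n W → Fin k) (next : Fin k → QueryProgram n W) :
      QueryProgram n W

open Classical in
/-- The probability that the run of a program on the oracle `f` from the unit vector `ψ` ends with
a pair (output, number of queries made) in `E`. Along a measurement the state is projected without
being renormalised, so the squared norm at a leaf is the probability of reaching that leaf. -/
noncomputable def QueryProgram.prob {n : ℕ} {W : Type} [Fintype W] [DecidableEq W]
    (f : BitString n → Bool) : QueryProgram n W → StateVec n W → Set (ℝ × ℕ) → ℝ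
  | .output r, ψ, E => if (r, 0) ∈ E then ψ.normSq else 0
  | .unitary U next, ψ, E => next.prob f (Matrix.mulVec U.1 ψ) E
  | .query next, ψ, E => next.prob f (ψ.query f) {p | (p.1, p.2 + 1) ∈ E}
  | .measure _ g next, ψ, E => ∑ i, (next i).prob f (ψ.project g i) E

/-- A quantum query algorithm for an oracle on `n` bits: a finite-dimensional workspace with its
initial basis state, and a program. None of these depends on the oracle. -/
structure QueryAlgorithm (n : ℕ) where
  W : Type
  [fintypeW : Fintype W]
  [decEqW : DecidableEq W]
  init : W
  program : QueryProgram n W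

attribute [instance] QueryAlgorithm.fintypeW QueryAlgorithm.decEqW

/-- The probability that the algorithm, run on the oracle `f` from `|0^n, 0, init⟩`, ends with a
pair (output, number of queries made) in `E`. -/
noncomputable def QueryAlgorithm.prob {n : ℕ} (A : QueryAlgorithm n) (f : BitString n → Bool)
    (E : Set (ℝ × ℕ)) : ℝ :=
  A.program.prob f (StateVec.basis (fun _ => false, false, A.init)) E

/-! ### Unitary operators on finite label spaces -/

section Operators

open WithLp

/-! Let `A` be a Hadamard transform followed by a query, and let `V = A⁻¹ Z A` with `Z` the sign of
`b ⊕ a·x`. Then `V` is an involution costing two queries, and its diagonal entry at `v a = |0, 0,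
a⟩` is the Walsh coefficient at `a`. With `R` the reflection fixing the span of the `v a`, the
powers of `R V` act on `v a` like a rotation of cosine `walshCoeff f a`; only Gram matrices are
needed, no eigenvectors (`inner_pow_rotation`, `norm_sq_sum_pow_rotation`). Two queries prepare the
superposition of the `v a` with the Walsh coefficients as amplitudes.

A phase measurement with a window of small tails (`exists_window`) compares `|walshCoeff f a|` with
a threshold coherently for all `a`. The flagged probability is about at least `walshMax f ^ 2` when
the maximum is above the threshold, and tiny when it is below (`exists_walsh_filter`). Amplitude
estimation, which is the same spectral test applied to this circuit, separates the two cases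
(`exists_threshold_test`). At accuracy `2⁻ⁱ`, with `walshMax f` at least about `2⁻ʲ` above the
threshold and error `2⁻ˢ`, the cost is of order `i 2ⁱ 2ʲ (j + s)`.

The search looks for the scale `2⁻ʲ` of `walshMax f` (`exists_locate`), then halves an interval
around it (`exists_refine`). Costs grow geometrically along the search, so the last tests dominate.
Errors are weighted geometrically too, with smaller errors demanded of the cheaper refinements, so
that no further logarithm appears. The factor `i` becomes `log (1 / lam)`, and `j + s` becomes the
other logarithm.

The query bound tends to zero as `lam` tends to one, and for `walshMax f = 1` also as `δ` tends to
one. In the first range a constant is accurate enough. In the second the final precision is partly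
guessed (`exists_guess`): a success probability of order `1 - δ` suffices, and the guess saves a
matching factor of queries. -/

/-- The operator on `ℂ^L`, `L ≃ P × K`, that acts as `U k` on the block of labels over `k`. -/
noncomputable def blockOp {L P K : Type*} [Fintype L] [Fintype P] [Fintype K] (e : L ≃ P × K)
    (U : K → (EuclideanSpace ℂ P ≃ₗᵢ[ℂ] EuclideanSpace ℂ P)) :
    EuclideanSpace ℂ L ≃ₗᵢ[ℂ] EuclideanSpace ℂ L where
  toFun ψ := toLp 2 fun l => U (e l).2 (toLp 2 fun p => ψ (e.symm (p, (e l).2))) (e l).1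
  invFun ψ := toLp 2 fun l => (U (e l).2).symm (toLp 2 fun p => ψ (e.symm (p, (e l).2))) (e l).1
  map_add' ψ φ := by
    ext l
    have : (toLp 2 fun p => (ψ + φ) (e.symm (p, (e l).2)) : EuclideanSpace ℂ P) =
        toLp 2 (fun p => ψ (e.symm (p, (e l).2))) + toLp 2 fun p => φ (e.symm (p, (e l).2)) := rfl
    simp only [PiLp.add_apply] at this ⊢
    rw [this, map_add, PiLp.add_apply]
  map_smul' c ψ := by
    ext l
    have : (toLp 2 fun p => (c • ψ) (e.symm (p, (e l).2)) : EuclideanSpace ℂ P) =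
        c • toLp 2 (fun p => ψ (e.symm (p, (e l).2))) := rfl
    simp only [PiLp.smul_apply, RingHom.id_apply] at this ⊢
    rw [this, map_smul, PiLp.smul_apply]
  left_inv ψ := by
    ext l
    simp
  right_inv ψ := by
    ext l
    simp
  norm_map' ψ := by
    refine (sq_eq_sq₀ (norm_nonneg _) (norm_nonneg _)).1 ?_
    rw [EuclideanSpace.norm_sq_eq, EuclideanSpace.norm_sq_eq, ← e.symm.sum_comp,
      ← e.symm.sum_comp, Fintype.sum_prod_type_right, Fintype.sum_prod_type_right]
    refine Finset.sum_congr rfl fun k _ => ?_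
    have := (U k).norm_map (toLp 2 fun p => ψ (e.symm (p, k)))
    rw [← sq_eq_sq₀ (norm_nonneg _) (norm_nonneg _), EuclideanSpace.norm_sq_eq,
      EuclideanSpace.norm_sq_eq] at this
    simpa using this

variable {L P K : Type*} [Fintype L] [Fintype P] [Fintype K]

theorem blockOp_apply (e : L ≃ P × K) (U : K → (EuclideanSpace ℂ P ≃ₗᵢ[ℂ] EuclideanSpace ℂ P))
    (ψ : EuclideanSpace ℂ L) (l : L) :
    blockOp e U ψ l = U (e l).2 (toLp 2 fun p => ψ (e.symm (p, (e l).2))) (e l).1 := rfl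

theorem blockOp_mul (e : L ≃ P × K) (U V : K → (EuclideanSpace ℂ P ≃ₗᵢ[ℂ] EuclideanSpace ℂ P)) :
    blockOp e (fun k => U k * V k) = blockOp e U * blockOp e V := by
  ext ψ l
  simp [blockOp_apply, LinearIsometryEquiv.coe_mul]

theorem blockOp_one (e : L ≃ P × K) : blockOp e (fun _ => 1) = 1 := by
  ext ψ l
  simp [blockOp_apply]

/-- The diagonal operator with entry `-1` at the labels satisfying `s`, and `1` elsewhere. -/
noncomputable def signOp (s : L → Bool) : EuclideanSpace ℂ L ≃ₗᵢ[ℂ] EuclideanSpace ℂ L :=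
  LinearIsometryEquiv.piLpCongrRight 2 fun l =>
    if s l then LinearIsometryEquiv.neg ℂ else LinearIsometryEquiv.refl ℂ ℂ

theorem signOp_apply (s : L → Bool) (ψ : EuclideanSpace ℂ L) (l : L) :
    signOp s ψ l = if s l then -ψ l else ψ l := by
  simp only [signOp, LinearIsometryEquiv.piLpCongrRight_apply]
  split_ifs <;> simp

theorem signOp_mul_self (s : L → Bool) : signOp s * signOp s = 1 := by
  ext ψ l
  simp only [LinearIsometryEquiv.coe_mul, Function.comp, signOp_apply]
  split_ifs <;> simp

/-- The operator permuting the standard basis by `σ`. -/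
noncomputable def permOp (σ : Equiv.Perm L) : EuclideanSpace ℂ L ≃ₗᵢ[ℂ] EuclideanSpace ℂ L :=
  LinearIsometryEquiv.piLpCongrLeft 2 ℂ ℂ σ

theorem permOp_apply (σ : Equiv.Perm L) (ψ : EuclideanSpace ℂ L) (l : L) :
    permOp σ ψ l = ψ (σ.symm l) := rfl

/-- A unit vector is the image of a basis vector under some unitary operator. -/
theorem exists_op_single_eq [DecidableEq L] (l : L) (u : EuclideanSpace ℂ L) (hu : ‖u‖ = 1) :
    ∃ U : EuclideanSpace ℂ L ≃ₗᵢ[ℂ] EuclideanSpace ℂ L, U (EuclideanSpace.single l 1) = u := by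
  have hv : Orthonormal ℂ (({l} : Set L).domRestrict fun _ : L => u) := by
    rw [orthonormal_iff_ite]
    rintro ⟨i, rfl⟩ ⟨j, rfl⟩
    simp [Set.domRestrict_apply, hu]
  obtain ⟨b, hb⟩ := hv.exists_orthonormalBasis_extension_of_card_eq (by simp)
  exact ⟨b.repr.symm, by simpa using hb l rfl⟩

/-- The operator given by a unitary matrix. -/
theorem exists_op_of_matrix [DecidableEq L] (M : Matrix L L ℂ) (hM : M.conjTranspose * M = 1) :
    ∃ U : EuclideanSpace ℂ L ≃ₗᵢ[ℂ] EuclideanSpace ℂ L,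
      ∀ ψ l, U ψ l = ∑ k, M l k * ψ k := by
  have hn : ∀ ψ, ‖(Matrix.toLpLin 2 2 M) ψ‖ = ‖ψ‖ := by
    intro ψ
    refine (sq_eq_sq₀ (norm_nonneg _) (norm_nonneg _)).1 ?_
    rw [← Complex.ofReal_inj]
    push_cast
    have h : ∀ φ : EuclideanSpace ℂ L, ((‖φ‖ : ℂ)) ^ 2 = star φ.ofLp ⬝ᵥ φ.ofLp := by
      intro φ
      rw [← Complex.ofReal_pow, EuclideanSpace.norm_sq_eq]
      simp [dotProduct, Complex.conj_mul']
    rw [h, h, Matrix.toLpLin_apply, Matrix.star_mulVec, Matrix.dotProduct_mulVec,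
      Matrix.vecMul_vecMul, hM, Matrix.vecMul_one]
  exact ⟨LinearIsometry.toLinearIsometryEquiv ⟨Matrix.toLpLin 2 2 M, hn⟩ rfl, fun ψ l => by
    simp [Matrix.toLpLin_apply, Matrix.mulVec, dotProduct]⟩

end Operators

/-! ### Query circuits and their embedding into adaptive programs -/

section Circuits

open WithLp

variable {n : ℕ} {W : Type} [Fintype W]

/-- The permutation `|x, b, w⟩ ↦ |x, b ⊕ f(x), w⟩` of the standard basis. -/
def queryPerm (f : BitString n → Bool) : Equiv.Perm (BasisLabel n W) :=
  Function.Involutive.toPerm (fun l => (l.1, xor l.2.1 (f l.1), l.2.2)) fun l => by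
    rcases l with ⟨x, b, w⟩
    simp

/-- The query operator as a unitary operator. -/
noncomputable def queryOp (f : BitString n → Bool) :
    EuclideanSpace ℂ (BasisLabel n W) ≃ₗᵢ[ℂ] EuclideanSpace ℂ (BasisLabel n W) :=
  permOp (queryPerm f)

theorem queryOp_apply (f : BitString n → Bool) (ψ : EuclideanSpace ℂ (BasisLabel n W))
    (l : BasisLabel n W) : queryOp f ψ l = ψ (l.1, xor l.2.1 (f l.1), l.2.2) := rfl

theorem queryOp_mul_self (f : BitString n → Bool) :
    queryOp f * queryOp f =
      (1 : EuclideanSpace ℂ (BasisLabel n W) ≃ₗᵢ[ℂ] EuclideanSpace ℂ (BasisLabel n W)) := by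
  ext ψ l
  simp [LinearIsometryEquiv.coe_mul, queryOp_apply]

/-- `Computes q F` means that `F f` is a product of `q` query operators of `f` and of unitary
operators that do not depend on `f`, the same for all `f`. -/
inductive Computes : ℕ → ((BitString n → Bool) →
    (EuclideanSpace ℂ (BasisLabel n W) ≃ₗᵢ[ℂ] EuclideanSpace ℂ (BasisLabel n W))) → Prop
  | const (U : EuclideanSpace ℂ (BasisLabel n W) ≃ₗᵢ[ℂ] EuclideanSpace ℂ (BasisLabel n W)) :
      Computes 0 fun _ => U
  | query : Computes 1 queryOp
  | mul {p q : ℕ} {F G : (BitString n → Bool) →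
      (EuclideanSpace ℂ (BasisLabel n W) ≃ₗᵢ[ℂ] EuclideanSpace ℂ (BasisLabel n W))} :
      Computes p F → Computes q G → Computes (p + q) fun f => F f * G f

variable {F : (BitString n → Bool) →
  (EuclideanSpace ℂ (BasisLabel n W) ≃ₗᵢ[ℂ] EuclideanSpace ℂ (BasisLabel n W))} {q : ℕ}

/-- The query operator is its own inverse, so running a circuit backwards costs the same. -/
theorem Computes.inv (h : Computes q F) : Computes q fun f => (F f)⁻¹ := by
  induction h with
  | const U => exact .const U⁻¹
  | query =>
    have : (fun f : BitString n → Bool => (queryOp f)⁻¹) =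
        (queryOp : _ → EuclideanSpace ℂ (BasisLabel n W) ≃ₗᵢ[ℂ] _) :=
      funext fun f => inv_eq_of_mul_eq_one_left (queryOp_mul_self f)
    rw [this]
    exact .query
  | mul _ _ h₁ h₂ =>
    simp only [mul_inv_rev]
    rw [add_comm]
    exact h₂.mul h₁

/-- Separates an additional workspace register from the label. -/
def registerEquiv (n : ℕ) (W K : Type) : BasisLabel n (W × K) ≃ BasisLabel n W × K where
  toFun l := ((l.1, l.2.1, l.2.2.1), l.2.2.2)
  invFun l := (l.1.1, l.1.2.1, l.1.2.2, l.2)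

/-- A query does not touch the workspace, so on the enlarged label it is again a single query. -/
theorem Computes.lift {K : Type} [Fintype K] (h : Computes q F) :
    Computes q fun f => blockOp (registerEquiv n W K) fun _ => F f := by
  induction h with
  | const U => exact .const _
  | query =>
    have : (fun f : BitString n → Bool => blockOp (registerEquiv n W K) fun _ => queryOp f) =
        queryOp := by
      funext f
      ext ψ l
      rfl
    rw [this]
    exact .query
  | mul _ _ h₁ h₂ =>
    have := h₁.mul h₂
    simpa only [← blockOp_mul] using this

/-- Controlled powers of `R A⁻¹ Z A` need only the operators `R` and `Z` to be controlled. -/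
theorem Computes.controlled_pow {N : ℕ} (h : Computes q F)
    (R Z : EuclideanSpace ℂ (BasisLabel n W) ≃ₗᵢ[ℂ] EuclideanSpace ℂ (BasisLabel n W)) (D : ℕ) :
    Computes (2 * q * D) fun f => blockOp (registerEquiv n W (Fin N)) fun k =>
      (R * ((F f)⁻¹ * Z * F f)) ^ min k.1 D := by
  induction D with
  | zero => simpa [blockOp_one] using Computes.const (n := n) (W := W × Fin N) 1
  | succ D ih =>
    -- One factor, switched on for `k > D`. When `R` and `Z` are switched off, the uncontrolled
    -- `A⁻¹` and `A` cancel, so no controlled query is needed.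
    have hstep : Computes (2 * q) fun f => blockOp (registerEquiv n W (Fin N)) fun k =>
        if D < k.1 then R * ((F f)⁻¹ * Z * F f) else 1 := by
      have h' := (((Computes.const (n := n) (W := W × Fin N)
        (blockOp (registerEquiv n W (Fin N)) fun k => if D < k.1 then R else 1)).mul
        (h.inv.lift (K := Fin N))).mul (Computes.const (n := n) (W := W × Fin N)
        (blockOp (registerEquiv n W (Fin N)) fun k => if D < k.1 then Z else 1))).mul
        (h.lift (K := Fin N))
      convert h' using 1
      · ring
      · funext f
        rw [← blockOp_mul, ← blockOp_mul, ← blockOp_mul]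
        congr 1
        funext k
        split_ifs <;> simp [mul_assoc]
    have h' := ih.mul hstep
    convert h' using 1
    · ring
    funext f
    rw [← blockOp_mul]
    congr 1
    funext k
    by_cases hk : D < k.1
    · rw [if_pos hk, min_eq_right hk, min_eq_right hk.le, pow_succ]
    · rw [if_neg hk, min_eq_left (by omega), min_eq_left (by omega), mul_one]

variable [DecidableEq W]

theorem exists_unitaryGroup_mulVec_eq
    (U : EuclideanSpace ℂ (BasisLabel n W) ≃ₗᵢ[ℂ] EuclideanSpace ℂ (BasisLabel n W)) :
    ∃ M : Matrix.unitaryGroup (BasisLabel n W) ℂ,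
      ∀ ψ : StateVec n W, Matrix.mulVec M.1 ψ = U (toLp 2 ψ) := by
  refine ⟨⟨_, U.toMatrix_mem_unitaryGroup (EuclideanSpace.basisFun _ ℂ)
    (EuclideanSpace.basisFun _ ℂ)⟩, fun ψ => ?_⟩
  have := LinearMap.toMatrix_mulVec_repr (EuclideanSpace.basisFun (BasisLabel n W) ℂ).toBasis
    (EuclideanSpace.basisFun (BasisLabel n W) ℂ).toBasis U.toLinearEquiv.toLinearMap (toLp 2 ψ)
  exact this

/-- A computed operator can be put in front of any program. -/
theorem Computes.exists_program (h : Computes q F) (next : QueryProgram n W) :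
    ∃ P : QueryProgram n W, ∀ f (ψ : StateVec n W) E,
      P.prob f ψ E = next.prob f (F f (toLp 2 ψ)) {p | (p.1, p.2 + q) ∈ E} := by
  induction h generalizing next with
  | const U =>
    obtain ⟨M, hM⟩ := exists_unitaryGroup_mulVec_eq U
    exact ⟨.unitary M next, fun f ψ E => by simp [QueryProgram.prob, hM]⟩
  | query => exact ⟨.query next, fun f ψ E => rfl⟩
  | mul _ _ h₁ h₂ =>
    obtain ⟨P₁, hP₁⟩ := h₁ next
    obtain ⟨P₂, hP₂⟩ := h₂ P₁
    refine ⟨P₂, fun f ψ E => ?_⟩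
    rw [hP₂, hP₁]
    simp only [Set.mem_ofPred_eq, add_assoc]
    rfl

namespace QueryProgram

/-- Projected states are not renormalised; this is how the weight of a measurement outcome is pulled
out as a factor. -/
theorem prob_smul (f : BitString n → Bool) (c : ℂ) (P : QueryProgram n W) (ψ : StateVec n W)
    (E : Set (ℝ × ℕ)) : P.prob f (c • ψ) E = ‖c‖ ^ 2 * P.prob f ψ E := by
  induction P generalizing ψ E with
  | output r => 
    simp only [prob]
    split_ifs
    · simp [StateVec.normSq, Finset.mul_sum, mul_pow]
    · simp
  | unitary U next ih => simp only [prob, Matrix.mulVec_smul, ih]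
  | query next ih => exact ih _ _
  | measure k g next ih =>
    simp only [prob, Finset.mul_sum]
    refine Finset.sum_congr rfl fun i _ => ?_
    rw [← ih]
    congr 1
    funext l
    simp [StateVec.project]

theorem prob_nonneg (f : BitString n → Bool) (P : QueryProgram n W) (ψ : StateVec n W)
    (E : Set (ℝ × ℕ)) : 0 ≤ P.prob f ψ E := by
  induction P generalizing ψ E with
  | output r =>
    simp only [prob]
    split_ifs
    · exact Finset.sum_nonneg fun _ _ => sq_nonneg _
    · exact le_rfl
  | unitary U next ih => exact ih _ _
  | query next ih => exact ih _ _
  | measure k g next ih => exact Finset.sum_nonneg fun i _ => ih _ _ _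

end QueryProgram

/-- Run a circuit on a basis state, measure the label completely, reset to the initial basis state
and go on according to the outcome of the measurement. -/
theorem Computes.exists_program_measure (h : Computes q F) (l₀ : BasisLabel n W)
    (next : BasisLabel n W → QueryProgram n W) :
    ∃ P : QueryProgram n W, ∀ f E, P.prob f (StateVec.basis l₀) E =
      ∑ l, ‖F f (EuclideanSpace.single l₀ 1) l‖ ^ 2 *
        (next l).prob f (StateVec.basis l₀) {p | (p.1, p.2 + q) ∈ E} := by
  let e := Fintype.equivFin (BasisLabel n W)
  -- A complete measurement leaves a multiple of a known basis vector, which a transposition of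
  -- labels sends back to `l₀`.
  have hreset : ∀ l, ∃ P : QueryProgram n W, ∀ f E (c : ℂ),
      P.prob f (c • StateVec.basis l) E = ‖c‖ ^ 2 * (next l).prob f (StateVec.basis l₀) E := by
    intro l
    obtain ⟨P, hP⟩ := (Computes.const (n := n) (permOp (Equiv.swap l l₀))).exists_program (next l)
    refine ⟨P, fun f E c => ?_⟩
    rw [hP, ← QueryProgram.prob_smul]
    congr 1
    funext k
    simp only [permOp_apply, StateVec.basis, Pi.smul_apply]
    rw [Equiv.symm_swap]
    have : Equiv.swap l l₀ k = l ↔ k = l₀ := by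
      rw [Equiv.swap_apply_eq_iff, Equiv.swap_apply_left]
    simp [this]
  choose R hR using hreset
  obtain ⟨P, hP⟩ := h.exists_program (.measure _ e fun i => R (e.symm i))
  refine ⟨P, fun f E => ?_⟩
  rw [hP]
  have h₀ : (toLp 2 (StateVec.basis l₀) : EuclideanSpace ℂ (BasisLabel n W)) =
      EuclideanSpace.single l₀ 1 := by
    ext l
    simp [StateVec.basis]
  simp only [QueryProgram.prob, h₀]
  rw [← e.sum_comp]
  refine Finset.sum_congr rfl fun l _ => ?_
  rw [← hR]
  simp only [Equiv.symm_apply_apply]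
  congr 1
  funext k
  by_cases hk : k = l
  · simp [StateVec.project, StateVec.basis, hk]
  · simp [StateVec.project, StateVec.basis, hk]

end Circuits

/-! ### The product of two reflections as a rotation -/

section Gram

open ComplexConjugate

variable {E ι : Type*} [NormedAddCommGroup E] [InnerProductSpace ℂ E]
  [DecidableEq ι]

/-- On a vector fixed by the involution `R` with `R V v + V v = 2 x v`, the product of the
involutions `R` and `V` acts like a rotation by an angle of cosine `x`. -/
theorem inner_pow_rotation (R V : E ≃ₗᵢ[ℂ] E) (hV : V * V = 1)
    (v : ι → E) (hv : Orthonormal ℂ v) (hRv : ∀ a, R (v a) = v a) (z : ι → ℂ)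
    (hz : ∀ a, ‖z a‖ = 1) (hRV : ∀ a, R (V (v a)) + V (v a) = (2 * ((z a).re : ℂ)) • v a)
    (a b : ι) (m : ℕ) :
    inner ℂ (v a) (((R * V) ^ m) (v b)) = if a = b then (((z b) ^ m).re : ℂ) else 0 := by
  have hvv := orthonormal_iff_ite.1 hv
  -- The Chebyshev recurrence. It follows from `R V v = 2 x v - V v`, `V² = 1` and `R v = v`; the
  -- numbers `Re (z ^ m)` satisfy the same one.
  have hrec : ∀ m, ((R * V) ^ (m + 2)) (v b) =
      (2 * ((z b).re : ℂ)) • ((R * V) ^ (m + 1)) (v b) - ((R * V) ^ m) (v b) := by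
    intro m
    have h₁ : (R * V) ((R * V) (v b)) = (2 * ((z b).re : ℂ)) • (R * V) (v b) - v b := by
      have h := hRV b
      have hVV : V (V (v b)) = v b := by
        simpa [LinearIsometryEquiv.coe_mul] using DFunLike.congr_fun hV (v b)
      have : (R * V) (v b) = (2 * ((z b).re : ℂ)) • v b - V (v b) := by
        rw [← h]
        simp [LinearIsometryEquiv.coe_mul]
      conv_lhs => rw [this]
      rw [map_sub, map_smul]
      simp [LinearIsometryEquiv.coe_mul, hVV, hRv]
    have h₂ : ((R * V) ^ (m + 2)) (v b) = ((R * V) ^ m) ((R * V) ((R * V) (v b))) := by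
      simp [pow_add, pow_two, LinearIsometryEquiv.coe_mul]
    have h₃ : ((R * V) ^ (m + 1)) (v b) = ((R * V) ^ m) ((R * V) (v b)) := by
      simp [pow_succ, LinearIsometryEquiv.coe_mul]
    rw [h₂, h₁, h₃, map_sub, map_smul]
  have hzrec : ∀ m, ((z b) ^ (m + 2)).re = 2 * (z b).re * ((z b) ^ (m + 1)).re - ((z b) ^ m).re := by
    intro m
    have hsq : (z b).re * (z b).re + (z b).im * (z b).im = 1 := by
      rw [← Complex.normSq_apply, Complex.normSq_eq_norm_sq, hz, one_pow]
    have h2 : (z b) ^ 2 = 2 * ((z b).re : ℂ) * z b - 1 := by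
      apply Complex.ext
      · simp [pow_two]
        linarith
      · simp [pow_two]
        ring
    have : (z b) ^ (m + 2) = 2 * ((z b).re : ℂ) * (z b) ^ (m + 1) - (z b) ^ m := by
      rw [pow_add, h2]
      ring
    rw [this]
    simp
  suffices h : ∀ m, inner ℂ (v a) (((R * V) ^ m) (v b)) =
      (if a = b then (((z b) ^ m).re : ℂ) else 0) ∧
      inner ℂ (v a) (((R * V) ^ (m + 1)) (v b)) =
      (if a = b then (((z b) ^ (m + 1)).re : ℂ) else 0) from (h m).1
  intro m
  induction m with
  | zero =>
    refine ⟨by simp [hvv], ?_⟩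
    have h₁ : inner ℂ (v a) (R (V (v b))) = inner ℂ (v a) (V (v b)) := by
      conv_lhs => rw [← hRv a]
      exact R.inner_map_map _ _
    have h₂ := congrArg (inner ℂ (v a)) (hRV b)
    rw [inner_add_right, h₁, inner_smul_right, hvv] at h₂
    simp only [zero_add, pow_one, LinearIsometryEquiv.coe_mul, Function.comp, h₁]
    split_ifs at h₂ ⊢
    · linear_combination h₂ / 2
    · linear_combination h₂ / 2
  | succ m ih =>
    refine ⟨ih.2, ?_⟩
    rw [hrec, inner_sub_right, inner_smul_right, ih.1, ih.2, hzrec]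
    split_ifs
    · push_cast
      ring
    · simp

variable [Fintype ι]

/-- Linear combinations of powers of the rotation have the same norm as if the rotation were
diagonal with the eigenvalues `z a` and `conj (z a)`, each with half of the weight of `v a`. -/
theorem norm_sq_sum_pow_rotation (R V : E ≃ₗᵢ[ℂ] E) (hV : V * V = 1)
    (v : ι → E) (hv : Orthonormal ℂ v) (hRv : ∀ a, R (v a) = v a) (z : ι → ℂ)
    (hz : ∀ a, ‖z a‖ = 1) (hRV : ∀ a, R (V (v a)) + V (v a) = (2 * ((z a).re : ℂ)) • v a)
    (c : ι → ℂ) {κ : Type*} [Fintype κ] (β : κ → ℂ) (e : κ → ℕ) :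
    ‖∑ k, β k • ((R * V) ^ e k) (∑ a, c a • v a)‖ ^ 2 =
      ∑ a, ‖c a‖ ^ 2 * ((‖∑ k, β k * z a ^ e k‖ ^ 2 + ‖∑ k, β k * conj (z a) ^ e k‖ ^ 2) / 2) := by
  set u := ∑ a, c a • v a with hu
  have hzz : ∀ a, conj (z a) * z a = 1 := fun a => by
    rw [Complex.conj_mul', hz]
    simp
  have h₀ : ∀ m, inner ℂ u (((R * V) ^ m) u) =
      ∑ a, ((‖c a‖ : ℂ)) ^ 2 * ((z a ^ m + conj (z a) ^ m) / 2) := by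
    intro m
    rw [hu, map_sum, sum_inner]
    refine Finset.sum_congr rfl fun a _ => ?_
    rw [inner_sum]
    simp only [map_smul, inner_smul_left, inner_smul_right,
      inner_pow_rotation R V hV v hv hRv z hz hRV]
    rw [Finset.sum_eq_single a (fun b _ hb => by simp [hb.symm]) (by simp), if_pos rfl,
      ← mul_assoc, mul_comm (c a), mul_assoc, ← map_pow, Complex.re_eq_add_conj,
      ← Complex.conj_mul']
    ring
  -- The common power is an isometry and drops out, leaving the exponent `q - p`. The other order
  -- follows by conjugation, and these inner products determine the norm.
  have h₁ : ∀ p q, p ≤ q → inner ℂ (((R * V) ^ p) u) (((R * V) ^ q) u) =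
      ∑ a, ((‖c a‖ : ℂ)) ^ 2 * ((conj (z a) ^ p * z a ^ q + z a ^ p * conj (z a) ^ q) / 2) := by
    intro p q hpq
    obtain ⟨m, rfl⟩ := Nat.exists_eq_add_of_le hpq
    rw [pow_add, LinearIsometryEquiv.coe_mul, Function.comp, LinearIsometryEquiv.inner_map_map, h₀]
    refine Finset.sum_congr rfl fun a _ => ?_
    rw [pow_add, pow_add, ← mul_assoc, ← mul_assoc, ← mul_pow, ← mul_pow, mul_comm (z a) (conj _),
      hzz, one_pow, one_mul, one_mul]
  have h₂ : ∀ p q, inner ℂ (((R * V) ^ p) u) (((R * V) ^ q) u) =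
      ∑ a, ((‖c a‖ : ℂ)) ^ 2 * ((conj (z a) ^ p * z a ^ q + z a ^ p * conj (z a) ^ q) / 2) := by
    intro p q
    rcases le_total p q with h | h
    · exact h₁ p q h
    · rw [← inner_conj_symm, h₁ q p h, map_sum]
      refine Finset.sum_congr rfl fun a _ => ?_
      simp only [map_mul, map_pow, map_div₀, map_add, Complex.conj_conj, Complex.conj_ofReal,
        map_ofNat]
      ring
  rw [← Complex.ofReal_inj]
  have h₃ : ((‖∑ k, β k • ((R * V) ^ e k) u‖ ^ 2 : ℝ) : ℂ) =
      inner ℂ (∑ k, β k • ((R * V) ^ e k) u) (∑ k, β k • ((R * V) ^ e k) u) := by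
    rw [inner_self_eq_norm_sq_to_K]
    simp
  have h₄ : ∀ y : ℂ, ((‖∑ k, β k * y ^ e k‖ : ℂ)) ^ 2 =
      ∑ k, ∑ l, conj (β k) * β l * (conj y ^ e k * y ^ e l) := by
    intro y
    rw [← Complex.conj_mul', map_sum, Finset.sum_mul_sum]
    refine Finset.sum_congr rfl fun k _ => Finset.sum_congr rfl fun l _ => ?_
    simp
    ring
  rw [h₃, sum_inner]
  push_cast
  simp only [h₄, inner_sum, inner_smul_left, inner_smul_right, h₂, Complex.conj_conj]
  simp only [Finset.mul_sum, Finset.sum_div, ← Finset.sum_add_distrib]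
  conv_rhs => rw [Finset.sum_comm]
  refine Finset.sum_congr rfl fun k _ => ?_
  conv_rhs => rw [Finset.sum_comm]
  refine Finset.sum_congr rfl fun l _ => Finset.sum_congr rfl fun a _ => ?_
  ring

end Gram

/-! ### Phase measurement with a rapidly decaying window -/

section Window

open WithLp ComplexConjugate

/-- The unnormalised window: the `r`-th power of the Dirichlet kernel of length `K`. -/
noncomputable def windowPoly (K r : ℕ) : Polynomial ℝ :=
  (∑ k ∈ Finset.range K, Polynomial.X ^ k) ^ r

theorem windowPoly_natDegree_lt {K r : ℕ} (hK : 1 ≤ K) (hr : 1 ≤ r) :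
    (windowPoly K r).natDegree < r * K := by
  have h₁ : (∑ k ∈ Finset.range K, (Polynomial.X : Polynomial ℝ) ^ k).natDegree ≤ K - 1 :=
    Polynomial.natDegree_sum_le_of_forall_le _ _ fun k hk => by
      rw [Polynomial.natDegree_X_pow]
      have := Finset.mem_range.1 hk
      omega
  calc (windowPoly K r).natDegree ≤ r * (K - 1) := Polynomial.natDegree_pow_le_of_le r h₁
    _ < r * K := Nat.mul_lt_mul_of_pos_left (by omega) hr

theorem norm_sum_pow_le {u : ℂ} (hu : ‖u‖ = 1) {g : ℝ} (hg : 0 < g) (h : g ≤ ‖1 - u‖) (K : ℕ) :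
    ‖∑ k ∈ Finset.range K, u ^ k‖ ≤ 2 / g := by
  rw [le_div_iff₀ hg]
  calc ‖∑ k ∈ Finset.range K, u ^ k‖ * g ≤ ‖∑ k ∈ Finset.range K, u ^ k‖ * ‖1 - u‖ := by gcongr
    _ = ‖1 - u ^ K‖ := by rw [← norm_mul, geom_sum_mul_neg]
    _ ≤ ‖(1 : ℂ)‖ + ‖u ^ K‖ := norm_sub_le _ _
    _ = 2 := by
      rw [norm_pow, hu]
      norm_num

/-- Unit vectors whose Fourier transform is concentrated around `1`. -/
theorem exists_window {K r : ℕ} (hK : 1 ≤ K) (hr : 1 ≤ r) :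
    ∃ w : ℕ → ℝ, (∀ k, r * K ≤ k → w k = 0) ∧ ∑ k ∈ Finset.range (r * K), w k ^ 2 = 1 ∧
      ∀ u : ℂ, ‖u‖ = 1 → ∀ g : ℝ, 0 < g → g ≤ ‖1 - u‖ → 4 ≤ K * g →
        ‖∑ k ∈ Finset.range (r * K), (w k : ℂ) * u ^ k‖ ^ 2 ≤ K / 2 ^ r := by
  set p := windowPoly K r with hp
  have hdeg := windowPoly_natDegree_lt hK hr
  rw [← hp] at hdeg
  set S := ∑ k ∈ Finset.range (r * K), p.coeff k ^ 2 with hS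
  have hK0 : (0 : ℝ) < K := by exact_mod_cast hK
  have hr0 : (0 : ℝ) < r := by exact_mod_cast hr
  have hsum : ∑ k ∈ Finset.range (r * K), p.coeff k = (K : ℝ) ^ r := by
    have := Polynomial.eval_eq_sum_range' hdeg 1
    simp only [one_pow, mul_one] at this
    rw [← this]
    simp [hp, windowPoly, Polynomial.eval_finsetSum]
  -- Cauchy–Schwarz over the `r * K` coefficients bounds the normalisation from below by the peak
  -- value at `1`. Away from the peak each of the `r` factors is at most `K / 2`, which leaves `r K
  -- / 4 ^ r ≤ K / 2 ^ r`.
  have hcs : ((K : ℝ) ^ r) ^ 2 ≤ r * K * S := by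
    have := sq_sum_le_card_mul_sum_sq (s := Finset.range (r * K)) (f := p.coeff)
    rw [hsum] at this
    simpa using this
  have hSpos : 0 < S := by
    by_contra hneg
    have : r * K * S ≤ 0 := mul_nonpos_of_nonneg_of_nonpos (by positivity) (not_lt.1 hneg)
    have : 0 < ((K : ℝ) ^ r) ^ 2 := by positivity
    linarith
  refine ⟨fun k => p.coeff k / √S, fun k hk => ?_, ?_, fun u hu g hg hgu hKg => ?_⟩
  · simp only [Polynomial.coeff_eq_zero_of_natDegree_lt (hdeg.trans_le hk), zero_div]
  · simp only [div_pow, Real.sq_sqrt hSpos.le]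
    rw [← Finset.sum_div, ← hS, div_self hSpos.ne']
  · have h₁ : ∑ k ∈ Finset.range (r * K), ((p.coeff k / √S : ℝ) : ℂ) * u ^ k =
        (∑ k ∈ Finset.range K, u ^ k) ^ r / (√S : ℂ) := by
      have := Polynomial.eval₂_eq_sum_range' (Complex.ofRealHom) hdeg u
      have h' : p.eval₂ Complex.ofRealHom u = (∑ k ∈ Finset.range K, u ^ k) ^ r := by
        rw [hp, windowPoly, Polynomial.eval₂_pow, Polynomial.eval₂_finsetSum]
        simp only [Polynomial.eval₂_X_pow]
      rw [← h', this, Finset.sum_div]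
      refine Finset.sum_congr rfl fun k _ => ?_
      simp
      ring
    have h₂ : ‖(√S : ℂ)‖ ^ 2 = S := by
      rw [Complex.norm_real, Real.norm_eq_abs, sq_abs, Real.sq_sqrt hSpos.le]
    rw [h₁, norm_div, div_pow, h₂, norm_pow, div_le_iff₀ hSpos]
    have h₃ : ‖∑ k ∈ Finset.range K, u ^ k‖ ≤ K / 2 := by
      refine (norm_sum_pow_le hu hg hgu K).trans ?_
      rw [div_le_div_iff₀ hg two_pos]
      linarith
    have h₄ : (r : ℝ) ≤ 2 ^ r := by exact_mod_cast Nat.lt_two_pow_self.le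
    calc (‖∑ k ∈ Finset.range K, u ^ k‖ ^ r) ^ 2 ≤ ((K / 2 : ℝ) ^ r) ^ 2 := by gcongr
      _ = ((K : ℝ) ^ r) ^ 2 / (2 ^ r * 2 ^ r) := by
        rw [div_pow]
        ring
      _ ≤ (2 ^ r * K * S) / (2 ^ r * 2 ^ r) := by
        gcongr
        refine hcs.trans ?_
        gcongr
      _ = K / 2 ^ r * S := by
        field_simp

/-- The discrete Fourier transform as a unitary operator. -/
theorem exists_dftOp (N : ℕ) [NeZero N] :
    ∃ (F : EuclideanSpace ℂ (Fin N) ≃ₗᵢ[ℂ] EuclideanSpace ℂ (Fin N)) (ω : Fin N → ℂ),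
      (∀ y, ‖ω y‖ = 1) ∧
      ∀ ψ y, F ψ y = (1 / √N : ℝ) * ∑ k : Fin N, conj (ω y) ^ k.1 * ψ k := by
  have hN : (N : ℝ) ≠ 0 := by exact_mod_cast NeZero.ne N
  set ζ := Complex.exp (2 * Real.pi * Complex.I / N) with hζ
  have hprim : IsPrimitiveRoot ζ N := Complex.isPrimitiveRoot_exp N (NeZero.ne N)
  have hnorm : ‖ζ‖ = 1 := hprim.norm'_eq_one (NeZero.ne N)
  have hconj : conj ζ * ζ = 1 := by
    rw [Complex.conj_mul', hnorm]
    simp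
  have hconj' : ∀ m, conj ζ ^ m * ζ ^ m = 1 := fun m => by rw [← mul_pow, hconj, one_pow]
  obtain ⟨F, hF⟩ := exists_op_of_matrix
    (Matrix.of fun y k : Fin N => ((1 / √N : ℝ) : ℂ) * conj (ζ ^ y.1) ^ k.1) (by
      ext k l
      simp only [Matrix.mul_apply, Matrix.conjTranspose_apply, Matrix.of_apply, Matrix.one_apply]
      have : ∀ y : Fin N, star (((1 / √N : ℝ) : ℂ) * conj (ζ ^ y.1) ^ k.1) *
          (((1 / √N : ℝ) : ℂ) * conj (ζ ^ y.1) ^ l.1) =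
          ((1 / N : ℝ) : ℂ) * (ζ ^ k.1 * conj ζ ^ l.1) ^ y.1 := by
        intro y
        have h₁ : ((1 / √N : ℝ) : ℂ) * ((1 / √N : ℝ) : ℂ) = ((1 / N : ℝ) : ℂ) := by
          rw [← Complex.ofReal_mul, div_mul_div_comm, Real.mul_self_sqrt (Nat.cast_nonneg N),
            one_mul]
        simp only [star_mul', Complex.star_def, Complex.conj_ofReal, map_pow, Complex.conj_conj]
        rw [← h₁]
        ring
      simp only [this, ← Finset.mul_sum]
      rw [Fin.sum_univ_eq_sum_range (fun y => (ζ ^ k.1 * conj ζ ^ l.1) ^ y)]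
      by_cases hkl : k = l
      · subst hkl
        simp only [mul_comm (ζ ^ k.1), hconj', one_pow, if_true]
        simp
      · have hne : ζ ^ k.1 * conj ζ ^ l.1 ≠ 1 := by
          intro h
          apply hkl
          apply Fin.ext
          apply hprim.pow_inj k.2 l.2
          calc ζ ^ k.1 = ζ ^ k.1 * (conj ζ ^ l.1 * ζ ^ l.1) := by rw [hconj', mul_one]
            _ = ζ ^ l.1 := by rw [← mul_assoc, h, one_mul]
        have hpow : (ζ ^ k.1 * conj ζ ^ l.1) ^ N = 1 := by
          rw [mul_pow, ← pow_mul, ← pow_mul, mul_comm k.1, mul_comm l.1, pow_mul, pow_mul,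
            ← map_pow, hprim.pow_eq_one]
          simp
        rw [if_neg hkl, geom_sum_eq hne, hpow, sub_self, zero_div, mul_zero])
  refine ⟨F, fun y => ζ ^ y.1, fun y => by rw [norm_pow, hnorm, one_pow], fun ψ y => ?_⟩
  rw [hF, Finset.mul_sum]
  simp [mul_assoc]

variable {N : ℕ}

/-- The amplitudes after the preparation `P` of the register from `|k₀⟩`, rotation of `|k⟩` by
`z ^ min k D`, and the operator `F`. -/
noncomputable def testAmplitude (P F : EuclideanSpace ℂ (Fin N) ≃ₗᵢ[ℂ] EuclideanSpace ℂ (Fin N))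
    (k₀ : Fin N) (D : ℕ) (z : ℂ) : EuclideanSpace ℂ (Fin N) :=
  F (toLp 2 fun k => P (EuclideanSpace.single k₀ 1) k * z ^ min k.1 D)

/-- The probability that the outcome is in `S`, for the eigenvalues `z` and `conj z` with
probability `1 / 2` each. -/
noncomputable def testResponse (P F : EuclideanSpace ℂ (Fin N) ≃ₗᵢ[ℂ] EuclideanSpace ℂ (Fin N))
    (k₀ : Fin N) (D : ℕ) (S : Fin N → Bool) (z : ℂ) : ℝ :=
  ∑ y, if S y then
    (‖testAmplitude P F k₀ D z y‖ ^ 2 + ‖testAmplitude P F k₀ D (conj z) y‖ ^ 2) / 2 else 0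

theorem sum_norm_sq_testAmplitude (P F : EuclideanSpace ℂ (Fin N) ≃ₗᵢ[ℂ] EuclideanSpace ℂ (Fin N))
    (k₀ : Fin N) (D : ℕ) {z : ℂ} (hz : ‖z‖ = 1) :
    ∑ y, ‖testAmplitude P F k₀ D z y‖ ^ 2 = 1 := by
  rw [← EuclideanSpace.norm_sq_eq, testAmplitude, LinearIsometryEquiv.norm_map,
    EuclideanSpace.norm_sq_eq]
  simp only [norm_mul, norm_pow, hz, one_pow, mul_one]
  rw [← EuclideanSpace.norm_sq_eq, LinearIsometryEquiv.norm_map]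
  simp

/-- Unitarity makes the outcome weights sum to one, so a lower bound on acceptance reduces to an
upper bound on rejection. -/
theorem testResponse_add_compl
    (P F : EuclideanSpace ℂ (Fin N) ≃ₗᵢ[ℂ] EuclideanSpace ℂ (Fin N)) (k₀ : Fin N) (D : ℕ)
    (S : Fin N → Bool) {z : ℂ} (hz : ‖z‖ = 1) :
    testResponse P F k₀ D S z + testResponse P F k₀ D (fun y => !S y) z = 1 := by
  have hz' : ‖conj z‖ = 1 := by simpa using hz
  rw [testResponse, testResponse, ← Finset.sum_add_distrib]
  calc _ = ∑ y, (‖testAmplitude P F k₀ D z y‖ ^ 2 +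
        ‖testAmplitude P F k₀ D (conj z) y‖ ^ 2) / 2 :=
        Finset.sum_congr rfl fun y _ => by cases S y <;> simp
    _ = 1 := by
      rw [← Finset.sum_div, Finset.sum_add_distrib, sum_norm_sq_testAmplitude P F k₀ D hz,
        sum_norm_sq_testAmplitude P F k₀ D hz']
      norm_num

theorem testResponse_nonneg
    (P F : EuclideanSpace ℂ (Fin N) ≃ₗᵢ[ℂ] EuclideanSpace ℂ (Fin N)) (k₀ : Fin N) (D : ℕ)
    (S : Fin N → Bool) (z : ℂ) : 0 ≤ testResponse P F k₀ D S z :=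
  Finset.sum_nonneg fun y _ => by split_ifs <;> positivity

/-- For every `1`-Lipschitz statistic `h` of the eigenvalue there is a test that compares `h z` with
a threshold up to the accuracy `g`. -/
theorem exists_spectral_test [NeZero N] {K r : ℕ} (hK : 1 ≤ K) (hr : 1 ≤ r) (hN : r * K ≤ N)
    (k₀ : Fin N) (h : ℂ → ℝ) (hlip : ∀ x y, |h x - h y| ≤ ‖x - y‖) (hconj : ∀ x, h (conj x) = h x)
    (θ : ℝ) {g : ℝ} (hg : 0 < g) (hKg : 4 ≤ K * g) :
    ∃ (P F : EuclideanSpace ℂ (Fin N) ≃ₗᵢ[ℂ] EuclideanSpace ℂ (Fin N)) (S : Fin N → Bool),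
      ∀ z, ‖z‖ = 1 →
        (θ + g ≤ h z → 1 - K / 2 ^ r ≤ testResponse P F k₀ (r * K) S z) ∧
        (h z ≤ θ - g → testResponse P F k₀ (r * K) S z ≤ K / 2 ^ r) := by
  obtain ⟨w, hw₀, hw₁, hw⟩ := exists_window hK hr
  obtain ⟨F, ω, hω, hF⟩ := exists_dftOp N
  have hext : ∀ φ : ℕ → ℂ, (∀ k, r * K ≤ k → φ k = 0) →
      ∑ k : Fin N, φ k = ∑ k ∈ Finset.range (r * K), φ k := by
    intro φ hφ
    rw [Fin.sum_univ_eq_sum_range]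
    refine (Finset.sum_subset (Finset.range_subset_range.2 hN) fun k _ hk => ?_).symm
    exact hφ k (by simpa using hk)
  obtain ⟨P, hP⟩ := exists_op_single_eq k₀ (toLp 2 fun k : Fin N => (w k : ℂ)) (by
    rw [← sq_eq_sq₀ (norm_nonneg _) zero_le_one, EuclideanSpace.norm_sq_eq, one_pow, ← hw₁]
    rw [← Complex.ofReal_inj]
    push_cast
    rw [← hext (fun k => (w k : ℂ) ^ 2) fun k hk => by simp [hw₀ k hk]]
    refine Finset.sum_congr rfl fun k _ => ?_
    rw [← Complex.ofReal_pow, ← Complex.ofReal_pow]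
    simp)
  have hN0 : (N : ℝ) ≠ 0 := by exact_mod_cast NeZero.ne N
  have hamp : ∀ z, ‖z‖ = 1 → ∀ y, g ≤ ‖ω y - z‖ →
      ‖testAmplitude P F k₀ (r * K) z y‖ ^ 2 ≤ (1 / N) * (K / 2 ^ r) := by
    intro z hz y hy
    have hωω : ω y * conj (ω y) = 1 := by
      rw [Complex.mul_conj', hω]
      simp
    have h₁ : testAmplitude P F k₀ (r * K) z y =
        (1 / √N : ℝ) * ∑ k ∈ Finset.range (r * K), (w k : ℂ) * (conj (ω y) * z) ^ k := by
      rw [testAmplitude, hF, hP, ← hext (fun k => (w k : ℂ) * (conj (ω y) * z) ^ k)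
        fun k hk => by simp [hw₀ k hk]]
      congr 1
      refine Finset.sum_congr rfl fun k _ => ?_
      simp only
      -- The cap on the exponent is invisible: the window vanishes from `r * K` on.
      rcases le_total (r * K) k.1 with hk | hk
      · simp [hw₀ _ hk]
      · rw [min_eq_left hk]
        ring
    rw [h₁, norm_mul, mul_pow]
    have h₂ : ‖((1 / √N : ℝ) : ℂ)‖ ^ 2 = 1 / N := by
      rw [Complex.norm_real, Real.norm_eq_abs, sq_abs, div_pow, Real.sq_sqrt (Nat.cast_nonneg N),
        one_pow]
    rw [h₂]
    gcongr
    refine hw _ (by rw [norm_mul, hz, RCLike.norm_conj, hω, one_mul]) g hg ?_ hKg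
    calc g ≤ ‖ω y - z‖ := hy
      _ = ‖ω y * (1 - conj (ω y) * z)‖ := by rw [mul_sub, ← mul_assoc, hωω, mul_one, one_mul]
      _ = _ := by rw [norm_mul, hω, one_mul]
  -- Each bad outcome has weight at most `1 / N` of the window error and there are at most `N` of
  -- them. The bound is thus independent of `N`, so one register size can serve all tests.
  have hresp : ∀ (S : Fin N → Bool) z, ‖z‖ = 1 →
      (∀ y, S y = true → g ≤ |h (ω y) - h z|) →
      testResponse P F k₀ (r * K) S z ≤ K / 2 ^ r := by
    intro S z hz hS
    have hz' : ‖conj z‖ = 1 := by simpa using hz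
    calc testResponse P F k₀ (r * K) S z ≤ ∑ _y : Fin N, (1 / N : ℝ) * (K / 2 ^ r) := by
          refine Finset.sum_le_sum fun y _ => ?_
          split_ifs with hy
          · have h₁ := hamp z hz y ((hS y hy).trans (hlip _ _))
            have h₂ := hamp (conj z) hz' y (by
              refine (hS y hy).trans ?_
              rw [← hconj z]
              exact hlip _ _)
            linarith
          · positivity
      _ = K / 2 ^ r := by
        rw [Finset.sum_const, Finset.card_univ, Fintype.card_fin, nsmul_eq_mul, ← mul_assoc,
          mul_one_div_cancel hN0, one_mul]
  refine ⟨P, F, fun y => decide (θ ≤ h (ω y)), fun z hz => ⟨fun hθ => ?_, fun hθ => ?_⟩⟩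
  · rw [← testResponse_add_compl P F k₀ (r * K) (fun y => decide (θ ≤ h (ω y))) hz]
    have := hresp (fun y => !decide (θ ≤ h (ω y))) z hz fun y hy => by
      have hy' : h (ω y) < θ := by simpa using hy
      rw [abs_sub_comm]
      exact (by linarith : g ≤ h z - h (ω y)).trans (le_abs_self _)
    linarith
  · refine hresp _ z hz fun y hy => ?_
    have hy' : θ ≤ h (ω y) := by simpa using hy
    exact (by linarith : g ≤ h (ω y) - h z).trans (le_abs_self _)

end Window

/-! ### The spectral test as a circuit, and amplitude estimation -/

section TestCircuit

open WithLp ComplexConjugate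

variable {n : ℕ} {W : Type} [Fintype W]

theorem op_apply_eq_sum {L : Type*} [Fintype L] [DecidableEq L]
    (F : EuclideanSpace ℂ L ≃ₗᵢ[ℂ] EuclideanSpace ℂ L) (φ : EuclideanSpace ℂ L) (y : L) :
    F φ y = ∑ k, F (EuclideanSpace.single k 1) y * φ k := by
  have h : φ = ∑ k, φ k • EuclideanSpace.single k (1 : ℂ) := by
    ext l
    simp [Pi.single_apply]
  conv_lhs => rw [h]
  simp [mul_comm]

/-- The circuit of the spectral test: prepare the register, apply the power of `ρ` it controls, and
transform the register for the measurement. -/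
noncomputable def testCircuit {N : ℕ}
    (P F : EuclideanSpace ℂ (Fin N) ≃ₗᵢ[ℂ] EuclideanSpace ℂ (Fin N)) (D : ℕ)
    (ρ : EuclideanSpace ℂ (BasisLabel n W) ≃ₗᵢ[ℂ] EuclideanSpace ℂ (BasisLabel n W)) :
    EuclideanSpace ℂ (BasisLabel n (W × Fin N)) ≃ₗᵢ[ℂ]
      EuclideanSpace ℂ (BasisLabel n (W × Fin N)) :=
  blockOp ((registerEquiv n W (Fin N)).trans (Equiv.prodComm _ _)) (fun _ => F) *
    (blockOp (registerEquiv n W (Fin N)) (fun k => ρ ^ min k.1 D) *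
      blockOp ((registerEquiv n W (Fin N)).trans (Equiv.prodComm _ _)) (fun _ => P))

/-- The probability that a measurement of the label of `ψ` satisfies `S`. -/
noncomputable def measureProb {L : Type*} [Fintype L] (S : L → Bool) (ψ : EuclideanSpace ℂ L) : ℝ :=
  ∑ l, if S l then ‖ψ l‖ ^ 2 else 0

theorem measureProb_nonneg {L : Type*} [Fintype L] (S : L → Bool) (ψ : EuclideanSpace ℂ L) :
    0 ≤ measureProb S ψ :=
  Finset.sum_nonneg fun l _ => by split_ifs <;> positivity

theorem measureProb_add_compl {L : Type*} [Fintype L] (S : L → Bool) (ψ : EuclideanSpace ℂ L) :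
    measureProb S ψ + measureProb (fun l => !S l) ψ = ‖ψ‖ ^ 2 := by
  rw [measureProb, measureProb, ← Finset.sum_add_distrib, EuclideanSpace.norm_sq_eq]
  exact Finset.sum_congr rfl fun l _ => by cases S l <;> simp

/-- For each register outcome the remaining state is a linear combination of powers of `R V` applied
to one vector, so `norm_sq_sum_pow_rotation` turns its norm into a mixture over the eigenvalues `z
a` and their conjugates. -/
theorem measureProb_testCircuit {N : ℕ}
    (P F : EuclideanSpace ℂ (Fin N) ≃ₗᵢ[ℂ] EuclideanSpace ℂ (Fin N)) (D : ℕ) (k₀ : Fin N)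
    (S : Fin N → Bool) {ι : Type*} [Fintype ι] [DecidableEq ι]
    (R V : EuclideanSpace ℂ (BasisLabel n W) ≃ₗᵢ[ℂ] EuclideanSpace ℂ (BasisLabel n W))
    (hV : V * V = 1) (v : ι → EuclideanSpace ℂ (BasisLabel n W)) (hv : Orthonormal ℂ v)
    (hRv : ∀ a, R (v a) = v a) (z : ι → ℂ) (hz : ∀ a, ‖z a‖ = 1)
    (hRV : ∀ a, R (V (v a)) + V (v a) = (2 * ((z a).re : ℂ)) • v a) (c : ι → ℂ)
    (ψ : EuclideanSpace ℂ (BasisLabel n (W × Fin N)))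
    (hψ : ∀ l k, ψ ((registerEquiv n W (Fin N)).symm (l, k)) =
      if k = k₀ then (∑ a, c a • v a) l else 0) :
    measureProb (fun l => S l.2.2.2) (testCircuit P F D (R * V) ψ) =
      ∑ a, ‖c a‖ ^ 2 * testResponse P F k₀ D S (z a) := by
  set u := ∑ a, c a • v a with hu
  let β : Fin N → Fin N → ℂ := fun y k =>
    F (EuclideanSpace.single k 1) y * P (EuclideanSpace.single k₀ 1) k
  have hamp : ∀ l y, testCircuit P F D (R * V) ψ ((registerEquiv n W (Fin N)).symm (l, y)) =
      (∑ k, β y k • ((R * V) ^ min k.1 D) u) l := by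
    intro l y
    have h₁ : ∀ l k, blockOp ((registerEquiv n W (Fin N)).trans (Equiv.prodComm _ _)) (fun _ => P) ψ
        ((registerEquiv n W (Fin N)).symm (l, k)) = P (EuclideanSpace.single k₀ 1) k * u l := by
      intro l k
      rw [blockOp_apply]
      simp only [Equiv.trans_apply, Equiv.apply_symm_apply, Equiv.symm_trans_apply,
        Equiv.prodComm_apply, Equiv.prodComm_symm, Prod.swap_prod_mk, hψ]
      have : (toLp 2 fun p => if p = k₀ then u l else 0 : EuclideanSpace ℂ (Fin N)) =
          u l • EuclideanSpace.single k₀ 1 := by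
        ext k
        simp [PiLp.single_apply]
      rw [this, map_smul, PiLp.smul_apply, smul_eq_mul, mul_comm]
    have h₂ : ∀ l k, (blockOp (registerEquiv n W (Fin N)) (fun k => (R * V) ^ min k.1 D) *
        blockOp ((registerEquiv n W (Fin N)).trans (Equiv.prodComm _ _)) (fun _ => P)) ψ
        ((registerEquiv n W (Fin N)).symm (l, k)) =
        P (EuclideanSpace.single k₀ 1) k * ((R * V) ^ min k.1 D) u l := by
      intro l k
      rw [LinearIsometryEquiv.coe_mul, Function.comp, blockOp_apply]
      simp only [Equiv.apply_symm_apply, h₁]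
      have : (toLp 2 fun p => P (EuclideanSpace.single k₀ 1) k * u p :
          EuclideanSpace ℂ (BasisLabel n W)) = P (EuclideanSpace.single k₀ 1) k • u := rfl
      rw [this, map_smul, PiLp.smul_apply, smul_eq_mul]
    rw [testCircuit, LinearIsometryEquiv.coe_mul, Function.comp, blockOp_apply]
    simp only [Equiv.trans_apply, Equiv.apply_symm_apply, Equiv.symm_trans_apply,
        Equiv.prodComm_apply, Equiv.prodComm_symm, Prod.swap_prod_mk, h₂]
    rw [op_apply_eq_sum]
    simp [β, mul_assoc]
  have hβ : ∀ z y, testAmplitude P F k₀ D z y = ∑ k, β y k * z ^ min k.1 D := by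
    intro z y
    rw [testAmplitude, op_apply_eq_sum]
    simp [β, mul_assoc]
  rw [measureProb, ← (registerEquiv n W (Fin N)).symm.sum_comp, Fintype.sum_prod_type_right]
  simp only [hamp]
  have hS : ∀ (l : BasisLabel n W) (y : Fin N),
      ((registerEquiv n W (Fin N)).symm (l, y)).2.2.2 = y := fun l y => rfl
  have hy : ∀ y, ∑ l, ‖(∑ k, β y k • ((R * V) ^ min k.1 D) u) l‖ ^ 2 =
      ∑ a, ‖c a‖ ^ 2 * ((‖testAmplitude P F k₀ D (z a) y‖ ^ 2 +
        ‖testAmplitude P F k₀ D (conj (z a)) y‖ ^ 2) / 2) := by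
    intro y
    rw [← EuclideanSpace.norm_sq_eq, hu,
      norm_sq_sum_pow_rotation R V hV v hv hRv z hz hRV c (β y) fun k => min k.1 D]
    simp only [hβ]
  simp only [hS, testResponse, Finset.mul_sum]
  rw [Finset.sum_comm]
  conv_rhs => rw [Finset.sum_comm]
  rw [Finset.sum_comm]
  refine Finset.sum_congr rfl fun y _ => ?_
  cases S y
  · simp
  · simp only [if_true, hy]

theorem Computes.testCircuit {N : ℕ} {q : ℕ} {A : (BitString n → Bool) →
      (EuclideanSpace ℂ (BasisLabel n W) ≃ₗᵢ[ℂ] EuclideanSpace ℂ (BasisLabel n W))}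
    (h : Computes q A)
    (P F : EuclideanSpace ℂ (Fin N) ≃ₗᵢ[ℂ] EuclideanSpace ℂ (Fin N)) (D : ℕ)
    (R Z : EuclideanSpace ℂ (BasisLabel n W) ≃ₗᵢ[ℂ] EuclideanSpace ℂ (BasisLabel n W)) :
    Computes (2 * q * D) fun f => _root_.testCircuit P F D (R * ((A f)⁻¹ * Z * A f)) := by
  have := (Computes.const (n := n) (W := W × Fin N) (blockOp
    ((registerEquiv n W (Fin N)).trans (Equiv.prodComm _ _)) fun _ => F)).mul
    ((h.controlled_pow (N := N) R Z D).mul (Computes.const (n := n) (W := W × Fin N) (blockOp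
      ((registerEquiv n W (Fin N)).trans (Equiv.prodComm _ _)) fun _ => P)))
  simpa only [zero_add, add_zero] using! this

theorem conj_mul_self_eq_one {L : Type*} [Fintype L]
    {A Z : EuclideanSpace ℂ L ≃ₗᵢ[ℂ] EuclideanSpace ℂ L}
    (hZ : Z * Z = 1) : (A⁻¹ * Z * A) * (A⁻¹ * Z * A) = 1 := by
  have : (A⁻¹ * Z * A) * (A⁻¹ * Z * A) = A⁻¹ * (Z * Z) * A := by group
  rw [this, hZ]
  group

/-- A point of the unit circle with prescribed real part. -/
noncomputable def circlePoint (x : ℝ) : ℂ := ⟨x, √(1 - x ^ 2)⟩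

theorem norm_circlePoint {x : ℝ} (hx : |x| ≤ 1) : ‖circlePoint x‖ = 1 := by
  have h : 0 ≤ 1 - x ^ 2 := by
    have := (sq_le_one_iff_abs_le_one x).2 hx
    linarith
  rw [← sq_eq_sq₀ (norm_nonneg _) zero_le_one, ← Complex.normSq_eq_norm_sq, Complex.normSq_apply,
    circlePoint, Real.mul_self_sqrt h]
  ring

/-- The distance to `1` is a Lipschitz statistic that sees `√p` instead of `p`; this is the source
of the quadratic speed-up of amplitude estimation. -/
theorem norm_circlePoint_sub_one {p : ℝ} (h₀ : 0 ≤ p) (h₁ : p ≤ 1) :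
    ‖circlePoint (1 - 2 * p) - 1‖ = 2 * √p := by
  have h : 0 ≤ 1 - (1 - 2 * p) ^ 2 := by nlinarith
  rw [← sq_eq_sq₀ (norm_nonneg _) (by positivity), ← Complex.normSq_eq_norm_sq,
    Complex.normSq_apply, mul_pow, Real.sq_sqrt h₀]
  simp only [circlePoint, Complex.sub_re, Complex.sub_im, Complex.one_re, Complex.one_im, sub_zero]
  rw [Real.mul_self_sqrt h]
  ring

/-- Amplitude estimation: a circuit that decides whether the probability `p` with which the
measurement of the state computed by `A` satisfies `S` is large or small. -/
theorem Computes.exists_amplitude_test [DecidableEq W] {N : ℕ} [NeZero N] {q : ℕ}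
    {A : (BitString n → Bool) →
      (EuclideanSpace ℂ (BasisLabel n W) ≃ₗᵢ[ℂ] EuclideanSpace ℂ (BasisLabel n W))}
    (h : Computes q A) (l₀ : BasisLabel n W) (k₀ : Fin N) (S : BasisLabel n W → Bool)
    {K r : ℕ} (hK : 1 ≤ K) (hr : 1 ≤ r) (hN : r * K ≤ N) (θ : ℝ) {g : ℝ} (hg : 0 < g)
    (hKg : 4 ≤ K * g) :
    ∃ (T : (BitString n → Bool) → (EuclideanSpace ℂ (BasisLabel n (W × Fin N)) ≃ₗᵢ[ℂ]
        EuclideanSpace ℂ (BasisLabel n (W × Fin N)))) (S' : BasisLabel n (W × Fin N) → Bool),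
      Computes (2 * q * (r * K)) T ∧ ∀ f,
        (θ + g ≤ 2 * √(measureProb S (A f (EuclideanSpace.single l₀ 1))) → 1 - K / 2 ^ r ≤
          measureProb S' (T f
            (EuclideanSpace.single ((registerEquiv n W (Fin N)).symm (l₀, k₀)) 1))) ∧
        (2 * √(measureProb S (A f (EuclideanSpace.single l₀ 1))) ≤ θ - g →
          measureProb S' (T f
            (EuclideanSpace.single ((registerEquiv n W (Fin N)).symm (l₀, k₀)) 1)) ≤
              K / 2 ^ r) := by
  obtain ⟨P, F, S', hS'⟩ := exists_spectral_test hK hr hN k₀ (fun x => ‖x - 1‖)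
    (fun x y => by simpa using abs_norm_sub_norm_le (x - 1) (y - 1))
    (fun x => by
      rw [← RCLike.norm_conj, map_sub, Complex.conj_conj, map_one]) θ hg hKg
  set R : EuclideanSpace ℂ (BasisLabel n W) ≃ₗᵢ[ℂ] EuclideanSpace ℂ (BasisLabel n W) :=
    signOp fun l => decide (l ≠ l₀) with hR
  set Z : EuclideanSpace ℂ (BasisLabel n W) ≃ₗᵢ[ℂ] EuclideanSpace ℂ (BasisLabel n W) :=
    signOp S with hZ
  refine ⟨_, fun l => S' l.2.2.2, h.testCircuit P F (r * K) R Z, fun f => ?_⟩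
  set p := measureProb S (A f (EuclideanSpace.single l₀ 1)) with hp
  have hp₀ : 0 ≤ p := measureProb_nonneg _ _
  have hsum := measureProb_add_compl S (A f (EuclideanSpace.single l₀ 1))
  rw [LinearIsometryEquiv.norm_map, PiLp.norm_single, norm_one, one_pow, ← hp] at hsum
  have hp₁ : p ≤ 1 := by
    have := measureProb_nonneg (fun l => !S l) (A f (EuclideanSpace.single l₀ 1))
    linarith
  have hz : ‖circlePoint (1 - 2 * p)‖ = 1 :=
    norm_circlePoint (abs_le.2 ⟨by linarith, by linarith⟩)
  -- The diagonal entry is the expectation of the sign `Z` in the state `A |l₀⟩`. It is the cosine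
  -- of the rotation, here with a single vector `v`.
  have hin : ((A f)⁻¹ * Z * A f) (EuclideanSpace.single l₀ 1) l₀ = ((1 - 2 * p : ℝ) : ℂ) := by
    set φ := A f (EuclideanSpace.single l₀ 1) with hφ
    have h₁ : ((A f)⁻¹ * Z * A f) (EuclideanSpace.single l₀ 1) l₀ = inner ℂ φ (Z φ) := by
      have : ((A f)⁻¹ * Z * A f) (EuclideanSpace.single l₀ 1) l₀ =
          inner ℂ (EuclideanSpace.single l₀ (1 : ℂ))
            (((A f)⁻¹ * Z * A f) (EuclideanSpace.single l₀ 1)) := by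
        rw [EuclideanSpace.inner_single_left, map_one, one_mul]
      rw [this, ← (A f).inner_map_map]
      simp [LinearIsometryEquiv.coe_mul, ← hφ]
    have h₂ : 1 - 2 * p = measureProb (fun l => !S l) φ - measureProb S φ := by
      rw [hp] at *
      linarith
    rw [h₁, h₂, measureProb, measureProb, ← Finset.sum_sub_distrib, PiLp.inner_apply]
    push_cast
    refine Finset.sum_congr rfl fun l _ => ?_
    rw [hZ, signOp_apply]
    cases S l <;> simp [Complex.mul_conj']
  have key := measureProb_testCircuit P F (r * K) k₀ S' R ((A f)⁻¹ * Z * A f)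
    (conj_mul_self_eq_one (signOp_mul_self S))
    (fun _ : Unit => EuclideanSpace.single l₀ 1)
    (by
      rw [orthonormal_iff_ite]
      intro i j
      simp)
    (fun _ => by
      ext l
      rw [hR, signOp_apply]
      by_cases hl : l = l₀ <;> simp [hl])
    (fun _ => circlePoint (1 - 2 * p)) (fun _ => hz)
    (fun _ => by
      ext l
      rw [PiLp.add_apply, hR, signOp_apply, PiLp.smul_apply]
      by_cases hl : l = l₀
      · subst hl
        rw [hin]
        simp [circlePoint]
        ring
      · simp [hl]) (fun _ => 1)
    (EuclideanSpace.single ((registerEquiv n W (Fin N)).symm (l₀, k₀)) 1)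
    (fun l k => by
      rw [PiLp.single_apply]
      simp only [EmbeddingLike.apply_eq_iff_eq, Prod.mk.injEq]
      by_cases hk : k = k₀ <;> by_cases hl : l = l₀ <;> simp [hk, hl])
  simp only [Finset.univ_unique, Finset.sum_singleton, norm_one, one_pow, one_mul] at key
  rw [key, ← norm_circlePoint_sub_one hp₀ hp₁]
  exact hS' _ hz

end TestCircuit

/-! ### Walsh coefficients as matrix entries of an oracle reflection -/

section Walsh

open WithLp ComplexConjugate

variable {n : ℕ}

/-- The number of common ones of two bit strings. -/
def dotBits (a x : BitString n) : ℕ := ∑ i, (a i && x i).toNat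

theorem dotBits_comm (a x : BitString n) : dotBits a x = dotBits x a := by
  simp only [dotBits, Bool.and_comm]

theorem dotBits_zero (x : BitString n) : dotBits (fun _ => false) x = 0 := by
  simp [dotBits]

/-- Orthogonality of characters: the sum factors over the bits, and one differing bit gives a zero
factor. -/
theorem sum_neg_one_pow_dotBits (x x' : BitString n) :
    ∑ y, (-1 : ℂ) ^ dotBits y x * (-1) ^ dotBits y x' = if x = x' then 2 ^ n else 0 := by
  have h₁ : ∀ y : BitString n, (-1 : ℂ) ^ dotBits y x * (-1) ^ dotBits y x' =
      ∏ i, (-1 : ℂ) ^ (y i && x i).toNat * (-1) ^ (y i && x' i).toNat := by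
    intro y
    rw [Finset.prod_mul_distrib, Finset.prod_pow_eq_pow_sum, Finset.prod_pow_eq_pow_sum]
    rfl
  have h₂ : ∀ i, ∑ b : Bool, (-1 : ℂ) ^ (b && x i).toNat * (-1) ^ (b && x' i).toNat =
      if x i = x' i then 2 else 0 := by
    intro i
    cases x i <;> cases x' i <;> norm_num
  simp only [h₁]
  rw [← Fintype.prod_sum (fun i (b : Bool) =>
    (-1 : ℂ) ^ (b && x i).toNat * (-1) ^ (b && x' i).toNat)]
  simp only [h₂]
  split_ifs with h
  · subst h
    simp
  · obtain ⟨i, hi⟩ := Function.ne_iff.1 h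
    exact Finset.prod_eq_zero (Finset.mem_univ i) (if_neg hi)

/-- The Hadamard transform of `n` qubits. -/
theorem exists_hadamardOp (n : ℕ) :
    ∃ H : EuclideanSpace ℂ (BitString n) ≃ₗᵢ[ℂ] EuclideanSpace ℂ (BitString n), H * H = 1 ∧
      ∀ ψ y, H ψ y = ∑ x, ((1 / √(2 ^ n) : ℝ) : ℂ) * (-1) ^ dotBits y x * ψ x := by
  have hsq : ((1 / √(2 ^ n) : ℝ) : ℂ) * ((1 / √(2 ^ n) : ℝ) : ℂ) * 2 ^ n = 1 := by
    rw [← Complex.ofReal_mul, div_mul_div_comm, Real.mul_self_sqrt (by positivity)]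
    push_cast
    field_simp
  have hM : ∀ x x' : BitString n, ∑ y, (((1 / √(2 ^ n) : ℝ) : ℂ) * (-1) ^ dotBits y x) *
      (((1 / √(2 ^ n) : ℝ) : ℂ) * (-1) ^ dotBits y x') = if x = x' then 1 else 0 := by
    intro x x'
    calc _ = (((1 / √(2 ^ n) : ℝ) : ℂ) * ((1 / √(2 ^ n) : ℝ) : ℂ)) *
          ∑ y, (-1 : ℂ) ^ dotBits y x * (-1) ^ dotBits y x' := by
          rw [Finset.mul_sum]
          exact Finset.sum_congr rfl fun y _ => by ring
      _ = _ := by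
        rw [sum_neg_one_pow_dotBits]
        split_ifs
        · exact hsq
        · simp
  obtain ⟨H, hH⟩ := exists_op_of_matrix
    (Matrix.of fun y x : BitString n => ((1 / √(2 ^ n) : ℝ) : ℂ) * (-1) ^ dotBits y x) (by
      ext x x'
      simp only [Matrix.mul_apply, Matrix.conjTranspose_apply, Matrix.of_apply, Matrix.one_apply]
      rw [← hM]
      refine Finset.sum_congr rfl fun y _ => ?_
      rw [star_mul', star_pow, star_neg, star_one, Complex.star_def, Complex.conj_ofReal])
  refine ⟨H, ?_, hH⟩
  ext ψ y
  simp only [LinearIsometryEquiv.coe_mul, Function.comp, hH, Matrix.of_apply, Finset.mul_sum]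
  rw [Finset.sum_comm]
  have : ∀ x, ∑ x', (((1 / √(2 ^ n) : ℝ) : ℂ) * (-1) ^ dotBits y x') *
      (((1 / √(2 ^ n) : ℝ) : ℂ) * (-1) ^ dotBits x' x * ψ x) = if y = x then ψ x else 0 := by
    intro x
    calc _ = (∑ x', (((1 / √(2 ^ n) : ℝ) : ℂ) * (-1) ^ dotBits x' y) *
          (((1 / √(2 ^ n) : ℝ) : ℂ) * (-1) ^ dotBits x' x)) * ψ x := by
          rw [Finset.sum_mul]
          refine Finset.sum_congr rfl fun x' _ => ?_
          rw [dotBits_comm y]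
          ring
      _ = _ := by
        rw [hM]
        split_ifs <;> simp
  simp only [this]
  simp

/-- The oracle reflection whose matrix entry at `|0, 0, a⟩` is the Walsh-Hadamard coefficient
at `a`. -/
theorem exists_walsh_reflection (n : ℕ) :
    ∃ (A : (BitString n → Bool) → (EuclideanSpace ℂ (BasisLabel n (BitString n)) ≃ₗᵢ[ℂ]
        EuclideanSpace ℂ (BasisLabel n (BitString n)))) (s : BasisLabel n (BitString n) → Bool),
      Computes 1 A ∧ ∀ f a y b a',
        ((A f)⁻¹ * signOp s * A f) (EuclideanSpace.single ((fun _ => false), false, a) 1)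
          (y, b, a') = if b = false ∧ a' = a then
            ((1 / 2 ^ n * ∑ x, (-1) ^ ((f x).toNat + dotBits a x + dotBits y x) : ℝ) : ℂ)
            else 0 := by
  obtain ⟨H, hHH, hH⟩ := exists_hadamardOp n
  set G : EuclideanSpace ℂ (BasisLabel n (BitString n)) ≃ₗᵢ[ℂ]
      EuclideanSpace ℂ (BasisLabel n (BitString n)) :=
    blockOp (Equiv.refl (BitString n × Bool × BitString n)) (fun _ => H) with hG
  have hGG : G * G = 1 := by
    rw [hG, ← blockOp_mul]
    simp only [hHH]
    exact blockOp_one _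
  have hGapply : ∀ ψ y b a, G ψ (y, b, a) =
      ∑ x, ((1 / √(2 ^ n) : ℝ) : ℂ) * (-1) ^ dotBits y x * ψ (x, b, a) := by
    intro ψ y b a
    rw [hG, blockOp_apply]
    simp only [Equiv.refl_apply, Equiv.refl_symm, hH]
  have hinv : ∀ f : BitString n → Bool, (queryOp f * G)⁻¹ = G * queryOp f := by
    intro f
    rw [mul_inv_rev, inv_eq_of_mul_eq_one_left hGG, inv_eq_of_mul_eq_one_left (queryOp_mul_self f)]
  -- The sign is read from the answer qubit and the parity of `a·x`; the query inside `A⁻¹` then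
  -- uncomputes the answer.
  refine ⟨fun f => queryOp f * G, fun l => xor l.2.1 (decide (Odd (dotBits l.2.2 l.1))),
    by simpa using Computes.query.mul (Computes.const G), fun f a y b a' => ?_⟩
  simp only [hinv]
  simp only [LinearIsometryEquiv.coe_mul, Function.comp, hGapply, queryOp_apply, signOp_apply]
  have h₁ : ∀ x b', ∑ x', ((1 / √(2 ^ n) : ℝ) : ℂ) * (-1) ^ dotBits x x' *
      (EuclideanSpace.single ((fun _ => false : BitString n), false, a) (1 : ℂ) :
        EuclideanSpace ℂ (BasisLabel n (BitString n))) (x', b', a') =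
      if b' = false ∧ a' = a then ((1 / √(2 ^ n) : ℝ) : ℂ) else 0 := by
    intro x b'
    rw [Finset.sum_eq_single (fun _ => false)]
    · rw [dotBits_comm, dotBits_zero, PiLp.single_apply]
      simp only [Prod.mk.injEq, true_and]
      split_ifs <;> simp
    · intro x' _ hx'
      rw [PiLp.single_apply]
      simp [hx']
    · simp
  simp only [h₁, Bool.xor_assoc, Bool.xor_self, Bool.xor_false]
  by_cases hba : b = false ∧ a' = a
  · simp only [hba, and_self, if_true, Bool.false_xor]
    push_cast
    rw [Finset.mul_sum]
    refine Finset.sum_congr rfl fun x _ => ?_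
    have hsq : ((√(2 ^ n) : ℝ) : ℂ) * ((√(2 ^ n) : ℝ) : ℂ) = 2 ^ n := by
      rw [← Complex.ofReal_mul, Real.mul_self_sqrt (by positivity)]
      push_cast
      rfl
    have hsign : (if (f x ^^ decide (Odd (dotBits a x))) = true
        then -(1 / ((√(2 ^ n) : ℝ) : ℂ)) else 1 / ((√(2 ^ n) : ℝ) : ℂ)) =
        (-1) ^ ((f x).toNat + dotBits a x) * (1 / ((√(2 ^ n) : ℝ) : ℂ)) := by
      rw [pow_add]
      rcases Nat.even_or_odd (dotBits a x) with h | h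
      · cases f x <;> simp [h.neg_one_pow, h]
      · cases f x <;> simp [h.neg_one_pow, h]
    rw [hsign, pow_add _ _ (dotBits y x), ← hsq]
    ring
  · simp [hba]

theorem walshCoeff_eq (f : BitString n → Bool) (a : BitString n) :
    walshCoeff f a = 1 / 2 ^ n * ∑ x, (-1) ^ ((f x).toNat + dotBits a x) := rfl

theorem abs_walshCoeff_le_walshMax (f : BitString n → Bool) (a : BitString n) :
    |walshCoeff f a| ≤ walshMax f :=
  Finset.le_sup' (fun a => |walshCoeff f a|) (Finset.mem_univ a)

theorem exists_abs_walshCoeff_eq (f : BitString n → Bool) :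
    ∃ a, |walshCoeff f a| = walshMax f := by
  obtain ⟨a, _, ha⟩ := Finset.exists_mem_eq_sup' Finset.univ_nonempty
    fun a : BitString n => |walshCoeff f a|
  exact ⟨a, ha.symm⟩

theorem abs_walshCoeff_le_one (f : BitString n → Bool) (a : BitString n) :
    |walshCoeff f a| ≤ 1 := by
  have h : |∑ x : BitString n, (-1 : ℝ) ^ ((f x).toNat + dotBits a x)| ≤ 2 ^ n := by
    refine (Finset.abs_sum_le_sum_abs _ _).trans ?_
    simp
  rw [walshCoeff_eq, abs_mul, abs_of_nonneg (by positivity), one_div, inv_mul_le_iff₀ (by positivity),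
    mul_one]
  exact h

theorem walshMax_le_one (f : BitString n → Bool) : walshMax f ≤ 1 := by
  obtain ⟨a, ha⟩ := exists_abs_walshCoeff_eq f
  rw [← ha]
  exact abs_walshCoeff_le_one f a

theorem walshMax_nonneg (f : BitString n → Bool) : 0 ≤ walshMax f :=
  (abs_nonneg _).trans (abs_walshCoeff_le_walshMax f fun _ => false)

/-- A circuit whose measurement satisfies `S` with a probability that is large if `walshMax f` is
above a threshold, and small if it is below. -/
theorem exists_walsh_filter (n : ℕ) {N : ℕ} [NeZero N] {K r : ℕ} (hK : 1 ≤ K) (hr : 1 ≤ r)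
    (hN : r * K ≤ N) (k₀ : Fin N) (θ : ℝ) {g : ℝ} (hg : 0 < g) (hKg : 4 ≤ K * g) :
    ∃ (T : (BitString n → Bool) → (EuclideanSpace ℂ (BasisLabel n (BitString n × Fin N)) ≃ₗᵢ[ℂ]
        EuclideanSpace ℂ (BasisLabel n (BitString n × Fin N))))
      (S : BasisLabel n (BitString n × Fin N) → Bool),
      Computes (2 * (r * K) + 2) T ∧ ∀ f,
        (θ + g ≤ walshMax f → walshMax f ^ 2 * (1 - K / 2 ^ r) ≤ measureProb S (T f
          (EuclideanSpace.single (fun _ => false, false, fun _ => false, k₀) 1))) ∧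
        (walshMax f ≤ θ - g → measureProb S (T f
          (EuclideanSpace.single (fun _ => false, false, fun _ => false, k₀) 1)) ≤
            K / 2 ^ r) := by
  obtain ⟨P, F, S, hS⟩ := exists_spectral_test hK hr hN k₀ (fun x => |x.re|)
    (fun x y => by
      refine (abs_abs_sub_abs_le_abs_sub _ _).trans ?_
      rw [← Complex.sub_re]
      exact Complex.abs_re_le_norm _)
    (fun x => by simp) θ hg hKg
  obtain ⟨A, s, hA, hAs⟩ := exists_walsh_reflection n
  set R : EuclideanSpace ℂ (BasisLabel n (BitString n)) ≃ₗᵢ[ℂ]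
      EuclideanSpace ℂ (BasisLabel n (BitString n)) :=
    signOp (fun l => decide ¬ (l.1 = (fun _ => false) ∧ l.2.1 = false)) with hR
  -- On `|0, 0, 0⟩` the reflection produces the Walsh coefficients as amplitudes in the query
  -- register; the swap moves them to the index register.
  let σ : Equiv.Perm (BasisLabel n (BitString n)) :=
    Function.Involutive.toPerm (fun l => (l.2.2, l.2.1, l.1)) fun l => rfl
  let G : (BitString n → Bool) → (EuclideanSpace ℂ (BasisLabel n (BitString n)) ≃ₗᵢ[ℂ]
      EuclideanSpace ℂ (BasisLabel n (BitString n))) :=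
    fun f => permOp σ * ((A f)⁻¹ * signOp s * A f)
  have hGc : Computes 2 G :=
    (Computes.const (permOp σ)).mul ((hA.inv.mul (Computes.const (signOp s))).mul hA)
  let v : BitString n → EuclideanSpace ℂ (BasisLabel n (BitString n)) :=
    fun a => EuclideanSpace.single (fun _ => false, false, a) 1
  have hv : Orthonormal ℂ v := by
    rw [orthonormal_iff_ite]
    intro i j
    rw [EuclideanSpace.inner_single_left, PiLp.single_apply]
    simp
  have hG : ∀ f, G f (v fun _ => false) = ∑ a, ((walshCoeff f a : ℝ) : ℂ) • v a := by
    intro f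
    ext ⟨y, b, a'⟩
    have h₁ : G f (v fun _ => false) (y, b, a') =
        ((A f)⁻¹ * signOp s * A f) (v fun _ => false) (a', b, y) := rfl
    have h₂ : (∑ a, ((walshCoeff f a : ℝ) : ℂ) • v a) (y, b, a') =
        if y = (fun _ => false) ∧ b = false then ((walshCoeff f a' : ℝ) : ℂ) else 0 := by
      simp only [WithLp.ofLp_sum, Finset.sum_apply, PiLp.smul_apply, v, PiLp.single_apply,
        Prod.mk.injEq, smul_eq_mul, mul_ite, mul_one, mul_zero]
      by_cases h : y = (fun _ => false) ∧ b = false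
      · simp [h]
      · rw [if_neg h]
        refine Finset.sum_eq_zero fun a _ => if_neg fun h' => h ⟨h'.1, h'.2.1⟩
    rw [h₁, h₂, hAs]
    simp only [dotBits_zero, add_zero, walshCoeff_eq, and_comm]
  -- Parseval, obtained from the fact that the preparation is an isometry.
  have hnorm : ∀ f : BitString n → Bool, ∑ a, ‖((walshCoeff f a : ℝ) : ℂ)‖ ^ 2 = 1 := by
    intro f
    have h := congrArg (fun u => ‖u‖ ^ 2) (hG f)
    simp only [LinearIsometryEquiv.norm_map] at h
    have h' : ‖∑ a, ((walshCoeff f a : ℝ) : ℂ) • v a‖ ^ 2 =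
        ∑ a, ‖((walshCoeff f a : ℝ) : ℂ)‖ ^ 2 := by
      rw [← Complex.ofReal_inj]
      have := hv.inner_sum (fun a => ((walshCoeff f a : ℝ) : ℂ))
        (fun a => ((walshCoeff f a : ℝ) : ℂ)) Finset.univ
      rw [inner_self_eq_norm_sq_to_K] at this
      simpa [Complex.conj_mul', pow_two] using this
    rw [← h', ← h]
    simp [v]
  refine ⟨_, fun l => S l.2.2.2, by
    simpa using (hA.testCircuit P F (r * K) R (signOp s)).mul (hGc.lift (K := Fin N)), fun f => ?_⟩
  have hz : ∀ a, ‖circlePoint (walshCoeff f a)‖ = 1 := fun a =>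
    norm_circlePoint (abs_walshCoeff_le_one f a)
  have key := measureProb_testCircuit P F (r * K) k₀ S R ((A f)⁻¹ * signOp s * A f)
    (conj_mul_self_eq_one (signOp_mul_self s)) v hv
    (fun a => by
      ext ⟨y, b, a'⟩
      rw [hR, signOp_apply]
      by_cases h : y = (fun _ => false) ∧ b = false
      · simp [h]
      · have h₀ : v a (y, b, a') = 0 := by
          simp only [v, PiLp.single_apply, Prod.mk.injEq]
          exact if_neg fun h' => h ⟨h'.1, h'.2.1⟩
        simp [h₀])
    (fun a => circlePoint (walshCoeff f a)) hz
    -- `R + 1` is twice the projection onto zero query and answer registers, and the reflection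
    -- preserves the index `a`, so only the diagonal entry survives.
    (fun a => by
      ext ⟨y, b, a'⟩
      rw [PiLp.add_apply, hR, signOp_apply, PiLp.smul_apply]
      simp only [v]
      rw [hAs, PiLp.single_apply]
      simp only [Prod.mk.injEq]
      by_cases hy : y = fun _ => false
      · subst hy
        by_cases hb : b = false
        · by_cases ha : a' = a
          · simp only [hb, ha, dotBits_zero, add_zero, ← walshCoeff_eq, circlePoint]
            simp
            ring
          · simp [hb, ha]
        · simp [hb]
      · simp [hy])
    (fun a => ((walshCoeff f a : ℝ) : ℂ))
    (blockOp (registerEquiv n (BitString n) (Fin N)) (fun _ => G f)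
      (EuclideanSpace.single (fun _ => false, false, fun _ => false, k₀) 1))
    (fun l k => by
      rw [blockOp_apply, ← hG]
      simp only [Equiv.apply_symm_apply]
      have : (toLp 2 fun p => (EuclideanSpace.single ((fun _ => false : BitString n), false,
          (fun _ => false : BitString n), k₀) (1 : ℂ) :
          EuclideanSpace ℂ (BasisLabel n (BitString n × Fin N)))
          ((registerEquiv n (BitString n) (Fin N)).symm (p, k)) :
          EuclideanSpace ℂ (BasisLabel n (BitString n))) =
          if k = k₀ then v (fun _ => false) else 0 := by
        ext ⟨y, b, a⟩
        simp only [PiLp.single_apply, registerEquiv, Equiv.coe_fn_symm_mk, Prod.mk.injEq]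
        by_cases hk : k = k₀ <;> simp [hk, v, PiLp.single_apply]
      rw [this]
      split_ifs <;> simp)
  simp only [LinearIsometryEquiv.coe_mul, Function.comp]
  rw [key]
  constructor
  · intro hθ
    obtain ⟨a, ha⟩ := exists_abs_walshCoeff_eq f
    have h₁ := (hS _ (hz a)).1 (by rw [circlePoint]; simpa [ha] using hθ)
    have h₂ : ‖((walshCoeff f a : ℝ) : ℂ)‖ ^ 2 = walshMax f ^ 2 := by
      rw [Complex.norm_real, Real.norm_eq_abs, ha]
    calc walshMax f ^ 2 * (1 - K / 2 ^ r) ≤ ‖((walshCoeff f a : ℝ) : ℂ)‖ ^ 2 *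
          testResponse P F k₀ (r * K) S (circlePoint (walshCoeff f a)) := by
          rw [h₂]
          gcongr
      _ ≤ _ := Finset.single_le_sum (f := fun a => ‖((walshCoeff f a : ℝ) : ℂ)‖ ^ 2 *
          testResponse P F k₀ (r * K) S (circlePoint (walshCoeff f a)))
          (fun a _ => mul_nonneg (sq_nonneg _) (testResponse_nonneg _ _ _ _ _ _))
          (Finset.mem_univ a)
  · intro hθ
    calc _ ≤ ∑ a, ‖((walshCoeff f a : ℝ) : ℂ)‖ ^ 2 * ((K : ℝ) / 2 ^ r) := by
          refine Finset.sum_le_sum fun a _ => ?_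
          gcongr
          exact (hS _ (hz a)).2 ((abs_walshCoeff_le_walshMax f a).trans hθ)
      _ = (K : ℝ) / 2 ^ r := by rw [← Finset.sum_mul, hnorm, one_mul]

end Walsh

/-! ### Threshold test, branching and guessing -/

section Control

open WithLp

variable {n : ℕ}

/-- If all coefficients vanished, the reflection would send a unit vector to zero. -/
theorem walshMax_pos (f : BitString n → Bool) : 0 < walshMax f := by
  refine lt_of_le_of_ne (walshMax_nonneg f) fun h => ?_
  obtain ⟨A, s, -, hA⟩ := exists_walsh_reflection n
  have hzero : ∀ a, walshCoeff f a = 0 := fun a =>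
    abs_nonpos_iff.1 ((abs_walshCoeff_le_walshMax f a).trans h.symm.le)
  set φ : EuclideanSpace ℂ (BasisLabel n (BitString n)) :=
    EuclideanSpace.single (fun _ => false, false, fun _ => false) 1 with hφ
  have h₀ : ((A f)⁻¹ * signOp s * A f) φ = 0 := by
    ext ⟨y, b, a⟩
    rw [hA]
    simp only [dotBits_zero, add_zero, ← walshCoeff_eq, hzero]
    simp
  have h₁ := LinearIsometryEquiv.norm_map ((A f)⁻¹ * signOp s * A f) φ
  rw [h₀, hφ, PiLp.norm_single, norm_zero, norm_one] at h₁
  exact zero_ne_one h₁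

/-- The workspace of the algorithm: a register for the index of a Walsh-Hadamard coefficient, and
one register for each of the two spectral tests. -/
abbrev TestSpace (n N : ℕ) : Type := (BitString n × Fin N) × Fin N

/-- The initial label. -/
def initLabel (n N : ℕ) [NeZero N] : BasisLabel n (TestSpace n N) :=
  (fun _ => false, false, (fun _ => false, 0), 0)

/-- A circuit that compares `walshMax f` with the threshold `τ`, provided that `walshMax f` is not
too small in the case that it exceeds the threshold. -/
theorem exists_threshold_test (n : ℕ) {N : ℕ} [NeZero N] {i j s : ℕ} (hji : j ≤ i)
    (hN₁ : (3 * i + 10) * 2 ^ (i + 4) ≤ N) (hN₂ : (j + 5 + s) * 2 ^ (j + 5) ≤ N) (τ : ℝ) :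
    ∃ (T : (BitString n → Bool) → (EuclideanSpace ℂ (BasisLabel n (TestSpace n N)) ≃ₗᵢ[ℂ]
        EuclideanSpace ℂ (BasisLabel n (TestSpace n N))))
      (S : BasisLabel n (TestSpace n N) → Bool),
      Computes (2 * (2 * ((3 * i + 10) * 2 ^ (i + 4)) + 2) * ((j + 5 + s) * 2 ^ (j + 5))) T ∧
      ∀ f, (τ + 1 / 2 ^ (i + 2) ≤ walshMax f → 1 / 2 ^ (j + 1) ≤ walshMax f → 1 - 1 / 2 ^ s ≤
          measureProb S (T f (EuclideanSpace.single (initLabel n N) 1))) ∧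
        (walshMax f ≤ τ - 1 / 2 ^ (i + 2) →
          measureProb S (T f (EuclideanSpace.single (initLabel n N) 1)) ≤ 1 / 2 ^ s) := by
  -- `K` gives `K g = 4` exactly. The exponent `r` brings the filter error down to `2 ^ (-2 i - 6)`,
  -- at most `(2 ^ (-j - 3)) ^ 2` because `j ≤ i`.
  obtain ⟨A, S₁, hA, hAS⟩ := exists_walsh_filter n (N := N) (K := 2 ^ (i + 4)) (r := 3 * i + 10)
    Nat.one_le_two_pow (by omega) hN₁ 0 τ (g := 1 / 2 ^ (i + 2)) (by positivity) (by
      push_cast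
      rw [pow_add _ i 4, pow_add _ i 2]
      field_simp
      norm_num)
  -- The two sides of the threshold are `2 √p ≥ 2 ^ (-j - 1)` and `2 √p ≤ 2 ^ (-j - 2)`. Again `K g
  -- = 4`, and the error `K / 2 ^ r` is exactly `2 ^ (-s)`.
  obtain ⟨T, S, hT, hTS⟩ := hA.exists_amplitude_test
    (fun _ => false, false, fun _ => false, 0) (0 : Fin N) S₁ (K := 2 ^ (j + 5)) (r := j + 5 + s)
    Nat.one_le_two_pow (by omega) hN₂ (3 / 2 ^ (j + 3)) (g := 1 / 2 ^ (j + 3)) (by positivity) (by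
      push_cast
      rw [pow_add _ j 5, pow_add _ j 3]
      field_simp
      norm_num)
  refine ⟨T, S, hT, fun f => ?_⟩
  have hε₁ : (((2 ^ (i + 4) : ℕ) : ℝ)) / 2 ^ (3 * i + 10) ≤ (1 / 2 ^ (j + 3)) ^ 2 := by
    rw [div_pow, one_pow, ← pow_mul]
    push_cast
    rw [div_le_div_iff₀ (by positivity) (by positivity), one_mul, ← pow_add]
    exact pow_le_pow_right₀ one_le_two (by omega)
  have hε₂ : (((2 ^ (j + 5) : ℕ) : ℝ)) / 2 ^ (j + 5 + s) = 1 / 2 ^ s := by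
    push_cast
    rw [pow_add _ (j + 5) s]
    field_simp
  have hj3 : (1 : ℝ) / 2 ^ (j + 3) = (1 / 2 ^ (j + 1)) / 4 := by
    rw [pow_add _ j 3, pow_add _ j 1]
    field_simp
    norm_num
  have hj3' : (3 : ℝ) / 2 ^ (j + 3) = 3 * (1 / 2 ^ (j + 3)) := by ring
  have hx0 : (0 : ℝ) < 1 / 2 ^ (j + 1) := by positivity
  have hx1 : (1 : ℝ) / 2 ^ (j + 1) ≤ 1 := by
    rw [div_le_one (by positivity)]
    exact one_le_pow₀ one_le_two
  rw [hε₂, hj3', hj3] at hTS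
  rw [hj3] at hε₁
  set x : ℝ := 1 / 2 ^ (j + 1) with hx
  have hAf := hAS f
  have hTf := hTS f
  set p := measureProb S₁ (A f (EuclideanSpace.single (fun _ => false, false, fun _ => false, 0) 1))
    with hp
  refine ⟨fun h₁ h₂ => hTf.1 ?_, fun h₁ => hTf.2 ?_⟩
  · have h₃ := hAf.1 h₁
    have h₄ : (x / 2) ^ 2 ≤ p := by
      refine le_trans ?_ h₃
      have h₅ : x ^ 2 ≤ walshMax f ^ 2 := by gcongr
      have hxx : (x / 4) ^ 2 ≤ 3 / 4 := by nlinarith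
      have h₇ := mul_le_mul_of_nonneg_left
        (by linarith : (1 : ℝ) / 4 ≤ 1 - ((2 ^ (i + 4) : ℕ) : ℝ) / 2 ^ (3 * i + 10))
        (sq_nonneg (walshMax f))
      have h₈ : (x / 2) ^ 2 = x ^ 2 * (1 / 4) := by ring
      linarith
    have h₆ : x / 2 ≤ √p := Real.le_sqrt_of_sq_le h₄
    linarith
  · have h₃ := (hAf.2 h₁).trans hε₁
    have h₄ : √p ≤ x / 4 := by
      rw [← Real.sqrt_sq (by positivity : 0 ≤ x / 4)]
      exact Real.sqrt_le_sqrt h₃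
    linarith

/-- With probability at least `v`, the program returns an estimate of the non-linearity of `f` of
accuracy `lam` and makes at most `B` queries. -/
def Guarantee {N : ℕ} [NeZero N] (lam : ℝ) (P : QueryProgram n (TestSpace n N))
    (f : BitString n → Bool) (v B : ℝ) : Prop :=
  v ≤ P.prob f (StateVec.basis (initLabel n N))
    {p : ℝ × ℕ | |nonlinearity f - p.1| ≤ lam ∧ (p.2 : ℝ) ≤ B}

/-- An upper bound for the number of queries of the threshold test. -/
def testCost (i j s : ℕ) : ℝ := 4096 * (3 * i + 10) * 2 ^ i * 2 ^ j * (j + 5 + s)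

theorem testCost_ge (i j s : ℕ) :
    ((2 * (2 * ((3 * i + 10) * 2 ^ (i + 4)) + 2) * ((j + 5 + s) * 2 ^ (j + 5)) : ℕ) : ℝ) ≤
      testCost i j s := by
  have h : (1 : ℝ) ≤ (3 * i + 10) * 2 ^ (i + 4) := by
    have : (1 : ℝ) ≤ 2 ^ (i + 4) := one_le_pow₀ one_le_two
    have hi : (0 : ℝ) ≤ i := Nat.cast_nonneg i
    nlinarith
  push_cast
  calc (2 * (2 * ((3 * i + 10) * 2 ^ (i + 4)) + 2) * ((j + 5 + s) * 2 ^ (j + 5)) : ℝ) ≤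
      2 * (2 * ((3 * i + 10) * 2 ^ (i + 4)) + 2 * ((3 * i + 10) * 2 ^ (i + 4))) *
        ((j + 5 + s) * 2 ^ (j + 5)) := by
        gcongr
        linarith
    _ = testCost i j s := by
      rw [testCost, pow_add _ i 4, pow_add _ j 5]
      ring

theorem QueryProgram.prob_mono {W : Type} [Fintype W] [DecidableEq W] (f : BitString n → Bool)
    (P : QueryProgram n W) (ψ : StateVec n W) {E E' : Set (ℝ × ℕ)} (h : E ⊆ E') :
    P.prob f ψ E ≤ P.prob f ψ E' := by
  induction P generalizing ψ E E' with
  | output r =>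
    simp only [prob]
    have hn : 0 ≤ ψ.normSq := Finset.sum_nonneg fun _ _ => sq_nonneg _
    split_ifs with h₁ h₂ h₂
    · exact le_rfl
    · exact absurd (h h₁) h₂
    · exact hn
    · exact le_rfl
  | unitary U next ih => exact ih _ h
  | query next ih => exact ih _ fun p hp => h hp
  | measure k g next ih => exact Finset.sum_le_sum fun i _ => ih _ _ h

/-- A program that branches on the result of a threshold test. -/
theorem exists_branch (n : ℕ) {N : ℕ} [NeZero N] (lam : ℝ) {i j s : ℕ} (hji : j ≤ i)
    (hN₁ : (3 * i + 10) * 2 ^ (i + 4) ≤ N) (hN₂ : (j + 5 + s) * 2 ^ (j + 5) ≤ N) (τ : ℝ)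
    (P₁ P₀ : QueryProgram n (TestSpace n N)) :
    ∃ P : QueryProgram n (TestSpace n N), ∀ f v B, 0 ≤ v →
      (τ + 1 / 2 ^ (i + 2) ≤ walshMax f → 1 / 2 ^ (j + 1) ≤ walshMax f) →
      (τ - 1 / 2 ^ (i + 2) < walshMax f → Guarantee lam P₁ f v (B - testCost i j s)) →
      (walshMax f < τ + 1 / 2 ^ (i + 2) → Guarantee lam P₀ f v (B - testCost i j s)) →
      Guarantee lam P f (v * (1 - 1 / 2 ^ s)) B := by
  obtain ⟨T, S, hT, hS⟩ := exists_threshold_test n hji hN₁ hN₂ τ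
  obtain ⟨P, hP⟩ := hT.exists_program_measure (initLabel n N) fun l => if S l then P₁ else P₀
  refine ⟨P, fun f v B hv hprior h₁ h₀ => ?_⟩
  set u := T f (EuclideanSpace.single (initLabel n N) 1) with hu
  set E : Set (ℝ × ℕ) := {p | |nonlinearity f - p.1| ≤ lam ∧ (p.2 : ℝ) ≤ B - testCost i j s}
    with hE
  have hsub : E ⊆ {p | (p.1, p.2 + (2 * (2 * ((3 * i + 10) * 2 ^ (i + 4)) + 2) *
      ((j + 5 + s) * 2 ^ (j + 5)))) ∈
      {p : ℝ × ℕ | |nonlinearity f - p.1| ≤ lam ∧ (p.2 : ℝ) ≤ B}} := by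
    rintro ⟨r, q⟩ ⟨hr, hq⟩
    refine ⟨hr, ?_⟩
    have := testCost_ge i j s
    simp only at hq ⊢
    rw [Nat.cast_add]
    linarith
  have hsum : measureProb S u + measureProb (fun l => !S l) u = 1 := by
    rw [measureProb_add_compl, hu, LinearIsometryEquiv.norm_map, PiLp.norm_single]
    norm_num
  have key : measureProb S u * P₁.prob f (StateVec.basis (initLabel n N)) E +
      measureProb (fun l => !S l) u * P₀.prob f (StateVec.basis (initLabel n N)) E ≤
      P.prob f (StateVec.basis (initLabel n N))
        {p : ℝ × ℕ | |nonlinearity f - p.1| ≤ lam ∧ (p.2 : ℝ) ≤ B} := by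
    rw [hP, measureProb, measureProb, Finset.sum_mul, Finset.sum_mul, ← Finset.sum_add_distrib]
    refine Finset.sum_le_sum fun l _ => ?_
    cases S l
    · simpa using mul_le_mul_of_nonneg_left (P₀.prob_mono f _ hsub) (sq_nonneg ‖u l‖)
    · simpa using mul_le_mul_of_nonneg_left (P₁.prob_mono f _ hsub) (sq_nonneg ‖u l‖)
  refine le_trans ?_ key
  have hS₁ := measureProb_nonneg S u
  have hS₀ := measureProb_nonneg (fun l => !S l) u
  have hP₁ := P₁.prob_nonneg f (StateVec.basis (initLabel n N)) E
  have hP₀ := P₀.prob_nonneg f (StateVec.basis (initLabel n N)) E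
  have hs : (0 : ℝ) ≤ 1 / 2 ^ s := by positivity
  have hs1 : (1 : ℝ) / 2 ^ s ≤ 1 := by
    rw [div_le_one (by positivity)]
    exact one_le_pow₀ one_le_two
  -- Within the gap around `τ` the test promises nothing, but there both continuations are good.
  -- Only outside the gap does the error of the test count.
  rcases lt_or_ge (τ - 1 / 2 ^ (i + 2)) (walshMax f) with hlow | hlow
  · have h₁' : v ≤ P₁.prob f (StateVec.basis (initLabel n N)) E := h₁ hlow
    rcases lt_or_ge (walshMax f) (τ + 1 / 2 ^ (i + 2)) with hhigh | hhigh
    · have h₀' : v ≤ P₀.prob f (StateVec.basis (initLabel n N)) E := h₀ hhigh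
      have := mul_le_mul_of_nonneg_left h₁' hS₁
      have := mul_le_mul_of_nonneg_left h₀' hS₀
      nlinarith
    · have hp := (hS f).1 hhigh (hprior hhigh)
      have : v * (1 - 1 / 2 ^ s) ≤
          P₁.prob f (StateVec.basis (initLabel n N)) E * measureProb S u :=
        mul_le_mul h₁' hp (by linarith) hP₁
      have := mul_nonneg hS₀ hP₀
      linarith
  · have hhigh : walshMax f < τ + 1 / 2 ^ (i + 2) := by
      have : (0 : ℝ) < 1 / 2 ^ (i + 2) := by positivity
      linarith
    have h₀' : v ≤ P₀.prob f (StateVec.basis (initLabel n N)) E := h₀ hhigh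
    have hp := (hS f).2 hlow
    have : v * (1 - 1 / 2 ^ s) ≤
        P₀.prob f (StateVec.basis (initLabel n N)) E * measureProb (fun l => !S l) u :=
      mul_le_mul h₀' (by linarith) (by linarith) hP₀
    have := mul_nonneg hS₁ hP₁
    linarith

/-- A program without queries that refines an estimate of `walshMax f` by guessing. -/
theorem exists_guess (n : ℕ) {N : ℕ} [NeZero N] (lam : ℝ) {m t : ℕ} (hN : 2 ^ t ≤ N)
    (hlam : 1 / 2 ^ (m + t + 1) ≤ lam) (e : ℝ) :
    ∃ P : QueryProgram n (TestSpace n N), ∀ f B, 0 ≤ B → |walshMax f - e| ≤ 1 / 2 ^ m →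
      Guarantee lam P f (1 / 2 ^ t) B := by
  let φ : Fin (2 ^ t) → BasisLabel n (TestSpace n N) :=
    fun k => (fun _ => false, false, (fun _ => false, 0), Fin.castLE hN k)
  have hφ : Function.Injective φ := by
    intro k k' h
    simpa [φ] using h
  let u : EuclideanSpace ℂ (BasisLabel n (TestSpace n N)) :=
    toLp 2 fun l => if l ∈ Finset.univ.image φ then ((1 / √(2 ^ t) : ℝ) : ℂ) else 0
  have hval : ‖((1 / √(2 ^ t) : ℝ) : ℂ)‖ ^ 2 = 1 / 2 ^ t := by
    rw [Complex.norm_real, Real.norm_eq_abs, sq_abs, div_pow, Real.sq_sqrt (by positivity),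
      one_pow]
  have hu : ‖u‖ = 1 := by
    rw [← sq_eq_sq₀ (norm_nonneg _) zero_le_one, EuclideanSpace.norm_sq_eq, one_pow]
    have : ∀ l, ‖u l‖ ^ 2 = if l ∈ Finset.univ.image φ then (1 / 2 ^ t : ℝ) else 0 := by
      intro l
      simp only [u]
      split_ifs
      · exact hval
      · simp
    simp only [this]
    rw [Finset.sum_ite_mem, Finset.univ_inter, Finset.sum_const,
      Finset.card_image_of_injective _ hφ]
    simp
  obtain ⟨U, hU⟩ := exists_op_single_eq (initLabel n N) u hu
  -- The guess is the midpoint of one of `2 ^ t` equal cells of `[e - 2⁻ᵐ, e + 2⁻ᵐ]`. A cell has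
  -- half-width `2 ^ (-m - t)`, and passing to the non-linearity halves the error once more.
  let out : BasisLabel n (TestSpace n N) → ℝ := fun l =>
    1 / 2 - 1 / 2 * (e + ((2 * (l.2.2.2 : ℝ) + 1) / 2 ^ t - 1) / 2 ^ m)
  obtain ⟨P, hP⟩ := (Computes.const (n := n) U).exists_program_measure (initLabel n N)
    fun l => .output (out l)
  refine ⟨P, fun f B hB he => ?_⟩
  obtain ⟨k, hk⟩ : ∃ k : Fin (2 ^ t), |nonlinearity f - out (φ k)| ≤ lam := by
    have h2t : (0 : ℝ) < 2 ^ t := by positivity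
    have h2m : (0 : ℝ) < 2 ^ m := by positivity
    set y : ℝ := (walshMax f - e) * 2 ^ m with hy
    have hy1 : |y| ≤ 1 := by
      rw [hy, abs_mul, abs_of_pos h2m]
      rwa [le_div_iff₀ h2m] at he
    obtain ⟨k, hk⟩ : ∃ k : Fin (2 ^ t), |(y + 1) * 2 ^ t - (2 * (k : ℝ) + 1)| ≤ 1 := by
      have hy' := abs_le.1 hy1
      set x : ℝ := (y + 1) * 2 ^ t / 2 with hx
      have hx0 : 0 ≤ x := by
        have : 0 ≤ y + 1 := by linarith
        positivity
      have hx1 : x ≤ 2 ^ t := by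
        rw [hx]
        nlinarith
      -- The right endpoint would get an index out of range; it is put into the last cell.
      rcases hx1.lt_or_eq with hlt | heq
      · refine ⟨⟨⌊x⌋₊, ?_⟩, ?_⟩
        · rw [Nat.floor_lt hx0]
          exact_mod_cast hlt
        · have h₁ := Nat.floor_le hx0
          have h₂ := Nat.lt_floor_add_one x
          simp only
          rw [abs_le]
          constructor <;> linarith
      · refine ⟨⟨2 ^ t - 1, by have := Nat.one_le_two_pow (n := t); omega⟩, ?_⟩
        have : ((2 ^ t - 1 : ℕ) : ℝ) = 2 ^ t - 1 := by
          rw [Nat.cast_sub Nat.one_le_two_pow]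
          push_cast
          rfl
        simp only [this]
        rw [abs_le]
        constructor <;> linarith
    refine ⟨k, ?_⟩
    have h₁ : nonlinearity f - out (φ k) =
        -(((y + 1) * 2 ^ t - (2 * (k : ℝ) + 1)) / 2 ^ (m + t + 1)) := by
      simp only [nonlinearity, out, φ, Fin.val_castLE, hy]
      rw [pow_succ, pow_add]
      field_simp
      ring
    rw [h₁, abs_neg, abs_div, abs_of_pos (by positivity : (0 : ℝ) < 2 ^ (m + t + 1))]
    refine le_trans ?_ hlam
    gcongr
  rw [Guarantee, hP]
  refine le_trans ?_ (Finset.single_le_sum (fun l _ => mul_nonneg (sq_nonneg _)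
    (QueryProgram.prob_nonneg _ _ _ _)) (Finset.mem_univ (φ k)))
  have hmem : (out (φ k), 0) ∈ {p : ℝ × ℕ | (p.1, p.2 + 0) ∈
      {p : ℝ × ℕ | |nonlinearity f - p.1| ≤ lam ∧ (p.2 : ℝ) ≤ B}} :=
    ⟨hk, by simpa using hB⟩
  have hnorm : (StateVec.basis (initLabel n N)).normSq = 1 := by
    rw [StateVec.normSq, Finset.sum_eq_single (initLabel n N)]
    · simp [StateVec.basis]
    · intro l _ hl
      simp [StateVec.basis, hl]
    · simp
  rw [hU, QueryProgram.prob, if_pos hmem, hnorm, mul_one]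
  have : u (φ k) = ((1 / √(2 ^ t) : ℝ) : ℂ) := by
    simp [u]
  rw [this, hval]

end Control

/-! ### Search for the scale and refinement of the estimate -/

section Search

variable {n N : ℕ} [NeZero N]

theorem Guarantee.mono {lam : ℝ} {P : QueryProgram n (TestSpace n N)} {f : BitString n → Bool}
    {v v' B B' : ℝ} (h : Guarantee lam P f v B) (hv : v' ≤ v) (hB : B ≤ B') :
    Guarantee lam P f v' B' :=
  (hv.trans h).trans (P.prob_mono f _ fun _ hp => ⟨hp.1, hp.2.trans hB⟩)

theorem testCost_le {i j s m : ℕ} (him : i ≤ m) :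
    testCost i j s ≤ 4096 * (3 * m + 10) * 2 ^ i * 2 ^ j * (j + 5 + s) := by
  have : (i : ℝ) ≤ m := by exact_mod_cast him
  rw [testCost]
  gcongr

/-- Refines an estimate of `walshMax f` from the accuracy `1 / 2 ^ i` to `1 / 2 ^ m`, halving the
interval with two threshold tests at a time. -/
theorem exists_refine (n : ℕ) {N : ℕ} [NeZero N] {lam : ℝ} {m s t j : ℕ} (hjm : j ≤ m)
    (hN₁ : ∀ i ≤ m, (3 * i + 10) * 2 ^ (i + 4) ≤ N)
    (hN₂ : ∀ j ≤ m, ∀ s' ≤ s + m + 3, (j + 5 + s') * 2 ^ (j + 5) ≤ N)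
    (hN : 2 ^ t ≤ N) (hlam : 1 / 2 ^ (m + t + 1) ≤ lam) (d : ℕ) :
    ∀ (i : ℕ) (e : ℝ), i + d = m → j ≤ i →
      ∃ P : QueryProgram n (TestSpace n N), ∀ f (B : ℝ), 1 / 2 ^ (j + 1) ≤ walshMax f →
        |walshMax f - e| ≤ 1 / 2 ^ i →
        2 * (4096 * (3 * m + 10) * 2 ^ j) *
          (2 ^ m * (j + s + 9) - 2 ^ i * (j + s + 9 + d)) ≤ B →
        Guarantee lam P f (1 / 2 ^ t * (1 - 1 / 2 ^ (s + 1) * (1 - 1 / 2 ^ d))) B := by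
  induction d with
  | zero =>
    intro i e hi _
    obtain rfl : i = m := by omega
    obtain ⟨P, hP⟩ := exists_guess n (N := N) lam hN hlam e
    refine ⟨P, fun f B _ he hB => ?_⟩
    simpa using hP f B (by simpa using hB) he
  | succ d ih =>
    intro i e hi hji
    set u : ℝ := 1 / 2 ^ (i + 1) with hu
    obtain ⟨Pp, hPp⟩ := ih (i + 1) (e + u) (by omega) (by omega)
    obtain ⟨Pz, hPz⟩ := ih (i + 1) e (by omega) (by omega)
    obtain ⟨Pm, hPm⟩ := ih (i + 1) (e - u) (by omega) (by omega)
    -- Three overlapping intervals of half-width `u`, centred at `e - u`, `e`, `e + u`, cover the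
    -- old one. Thresholds `e ± u / 2` with gap `u / 2` make each choice permitted by a test valid.
    -- The exponent `s + d + 3` demands smaller errors early on, where tests are cheap.
    obtain ⟨Q, hQ⟩ := exists_branch n lam hji (hN₁ i (by omega))
      (hN₂ j hjm (s + d + 3) (by omega)) (e - u / 2) Pz Pm
    obtain ⟨P, hP⟩ := exists_branch n lam hji (hN₁ i (by omega))
      (hN₂ j hjm (s + d + 3) (by omega)) (e + u / 2) Pp Q
    refine ⟨P, fun f B hc he hB => ?_⟩
    have hg : (1 : ℝ) / 2 ^ (i + 2) = u / 2 := by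
      rw [hu, pow_succ _ (i + 1)]
      field_simp
    have hi2 : (1 : ℝ) / 2 ^ i = 2 * u := by
      rw [hu, pow_succ]
      field_simp
    rw [hg] at hP hQ
    rw [hi2] at he
    obtain ⟨he₁, he₂⟩ := abs_le.1 he
    set q := testCost i j (s + d + 3) with hq
    have hq0 : 0 ≤ q := by
      rw [hq, testCost]
      positivity
    -- The budget is a closed form that telescopes: one level lowers it by twice the bound for a
    -- test, `2 ^ i * (j + s + 8 + d)` up to the common factor, and it vanishes at `i = m`.
    have hcost : 2 * (4096 * (3 * m + 10) * 2 ^ j) *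
        (2 ^ m * (j + s + 9) - 2 ^ (i + 1) * (j + s + 9 + d)) ≤ B - q - q := by
      have h₁ : q ≤ 4096 * (3 * m + 10) * 2 ^ j * (2 ^ i * (j + s + 8 + d)) := by
        refine (testCost_le (m := m) (by omega)).trans (le_of_eq ?_)
        push_cast
        ring
      rw [pow_succ]
      push_cast at hB
      linarith
    set a : ℝ := 1 / 2 ^ (s + 1) with ha
    set b : ℝ := 1 / 2 ^ d with hb
    set w : ℝ := 1 / 2 ^ t with hw
    have ha0 : 0 ≤ a := by positivity
    have ha1 : a ≤ 1 := by
      rw [ha, div_le_one (by positivity)]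
      exact one_le_pow₀ one_le_two
    have hb0 : 0 ≤ b := by positivity
    have hb1 : b ≤ 1 := by
      rw [hb, div_le_one (by positivity)]
      exact one_le_pow₀ one_le_two
    have hw0 : 0 ≤ w := by positivity
    have hε : (1 : ℝ) / 2 ^ (s + d + 3) = a * b / 4 := by
      rw [ha, hb]
      field_simp
      ring
    have hb2 : (1 : ℝ) / 2 ^ (d + 1) = b / 2 := by
      rw [hb, pow_succ]
      field_simp
    rw [hε] at hP hQ
    rw [hb2]
    have hab : a * b ≤ 1 := mul_le_one₀ ha1 hb0 hb1
    have hab0 : 0 ≤ a * b := mul_nonneg ha0 hb0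
    set v : ℝ := w * (1 - a * (1 - b)) with hv
    have hx0 : 0 ≤ 1 - a * (1 - b) := by nlinarith
    have hv0 : 0 ≤ v := mul_nonneg hw0 hx0
    have hQf : walshMax f < e + u / 2 + u / 2 → Guarantee lam Q f (v * (1 - a * b / 4)) (B - q) := by
      intro hlt
      refine hQ f v (B - q) hv0 (fun _ => hc) (fun h => ?_) fun h => ?_
      · exact hPz f _ hc (abs_le.2 ⟨by linarith, by linarith⟩) hcost
      · exact hPm f _ hc (abs_le.2 ⟨by linarith, by linarith⟩) hcost
    have hle : v * (1 - a * b / 4) ≤ v := mul_le_of_le_one_right hv0 (by linarith)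
    have hPf := hP f (v * (1 - a * b / 4)) B (mul_nonneg hv0 (by linarith)) (fun _ => hc)
      (fun h => (hPp f _ hc (abs_le.2 ⟨by linarith, by linarith⟩) hcost).mono hle (by linarith))
      hQf
    refine hPf.mono ?_ le_rfl
    rw [hv, mul_assoc, mul_assoc]
    refine mul_le_mul_of_nonneg_left ?_ hw0
    have hx1 : 1 - a * (1 - b) ≤ 1 := by nlinarith
    have h₁ := mul_nonneg hx0 (sq_nonneg (a * b))
    have h₂ := mul_le_mul_of_nonneg_right hx1 hab0
    have h₃ : (1 - a * (1 - b)) * ((1 - a * b / 4) * (1 - a * b / 4)) = 1 - a * (1 - b) -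
        (1 - a * (1 - b)) * (a * b) / 2 + (1 - a * (1 - b)) * (a * b) ^ 2 / 16 := by ring
    rw [h₃]
    linarith

/-- Finds the magnitude `2 ^ -j` of `walshMax f` and continues with `exists_refine`. -/
theorem exists_locate (n : ℕ) {N : ℕ} [NeZero N] {lam : ℝ} {m s t : ℕ}
    (hN₁ : ∀ i ≤ m, (3 * i + 10) * 2 ^ (i + 4) ≤ N)
    (hN₂ : ∀ j ≤ m, ∀ s' ≤ s + m + 3, (j + 5 + s') * 2 ^ (j + 5) ≤ N)
    (hN : 2 ^ t ≤ N) (hlam : 1 / 2 ^ (m + t + 1) ≤ lam) (d : ℕ) :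
    ∀ j : ℕ, j + d = m → ∃ P : QueryProgram n (TestSpace n N), ∀ f (B Z : ℝ),
        (∀ k : ℕ, 2 ^ k * walshMax f ≤ 2 → 2 * k + 9 + s ≤ Z) →
        2 ^ j * walshMax f ≤ 2 →
        4096 * (3 * m + 10) * 2 ^ m * Z * (8 / walshMax f - 2 ^ j) ≤ B →
        Guarantee lam P f (1 / 2 ^ t * (1 - 1 / 2 ^ (s + 1) - 1 / 2 ^ (s + 1) * (1 / 2 ^ j))) B := by
  induction d with
  | zero =>
    intro j hj
    obtain rfl : j = m := by omega
    obtain ⟨P, hP⟩ := exists_guess n (N := N) lam hN hlam (1 / 2 ^ j)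
    refine ⟨P, fun f B Z hZ hc hB => ?_⟩
    have hpos := walshMax_pos f
    have hZj := hZ j hc
    have hZ0 : 0 ≤ Z := le_trans (by positivity) hZj
    have hj8 : (0 : ℝ) ≤ 8 / walshMax f - 2 ^ j := by
      rw [sub_nonneg, le_div_iff₀ hpos]
      linarith
    refine (hP f B (le_trans (by positivity) hB) ?_).mono ?_ le_rfl
    · have : walshMax f ≤ 2 * (1 / 2 ^ j) := by
        rw [mul_one_div, le_div_iff₀ (by positivity)]
        linarith
      rw [abs_le]
      constructor <;> linarith
    · refine mul_le_of_le_one_right (by positivity) ?_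
      have h₁ : (0 : ℝ) ≤ 1 / 2 ^ (s + 1) := by positivity
      have h₂ : (0 : ℝ) ≤ 1 / 2 ^ (s + 1) * (1 / 2 ^ j) := by positivity
      linarith
  | succ d ih =>
    intro j hj
    obtain ⟨P₁, hP₁⟩ := exists_refine n (N := N) (lam := lam) (m := m) (s := s) (t := t) (j := j)
      (by omega) hN₁ hN₂ hN hlam (d + 1) j (1 / 2 ^ j) (by omega) le_rfl
    obtain ⟨P₀, hP₀⟩ := ih (j + 1) (by omega)
    -- Threshold `3/4 · 2⁻ʲ` with gap `1/4 · 2⁻ʲ`: refinement is entered only above `2⁻ʲ / 2`, the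
    -- next scale only below `2⁻ʲ`. The errors `2 ^ (-s - j - 2)` are summable over the scales.
    obtain ⟨P, hP⟩ := exists_branch n lam le_rfl (hN₁ j (by omega))
      (hN₂ j (by omega) (s + j + 2) (by omega)) (3 / 4 * (1 / 2 ^ j)) P₁ P₀
    refine ⟨P, fun f B Z hZ hc hB => ?_⟩
    have hpos := walshMax_pos f
    have hZj := hZ j hc
    set a : ℝ := 1 / 2 ^ (s + 1) with ha
    set b : ℝ := 1 / 2 ^ j with hb
    set w : ℝ := 1 / 2 ^ t with hw
    have ha0 : 0 ≤ a := by positivity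
    have ha1 : a ≤ 1 / 2 := by
      rw [ha]
      refine one_div_le_one_div_of_le two_pos ?_
      exact le_self_pow₀ one_le_two (by omega)
    have hb0 : 0 < b := by positivity
    have hb1 : b ≤ 1 := by
      rw [hb, div_le_one (by positivity)]
      exact one_le_pow₀ one_le_two
    have hw0 : 0 ≤ w := by positivity
    have hε : (1 : ℝ) / 2 ^ (s + j + 2) = a * b / 2 := by
      rw [ha, hb]
      field_simp
      ring
    have hb2 : (1 : ℝ) / 2 ^ (j + 1) = b / 2 := by
      rw [hb, pow_succ]
      field_simp
    have hb4 : (1 : ℝ) / 2 ^ (j + 2) = b / 4 := by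
      rw [hb, pow_add]
      field_simp
      norm_num
    have hab0 : 0 ≤ a * b := by positivity
    have hab : a * b ≤ 1 / 2 := by nlinarith
    have hcb : walshMax f ≤ 2 * b := by
      rw [hb, mul_one_div, le_div_iff₀ (by positivity)]
      linarith
    rw [hε, hb4, hb2] at hP
    rw [hb2] at hP₀ hP₁
    set U : ℝ := 4096 * (3 * m + 10) * 2 ^ m with hU
    have hU0 : 0 ≤ U := by positivity
    set q := testCost j j (s + j + 2) with hq
    have h2j : (2 : ℝ) ^ j * (4 * walshMax f) ≤ 8 := by linarith
    have h8 : 4 * (2 : ℝ) ^ j ≤ 8 / walshMax f := by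
      rw [le_div_iff₀ hpos]
      linarith
    have hpow : (2 : ℝ) ^ j ≤ 2 ^ m := pow_le_pow_right₀ one_le_two (by omega)
    -- A step to the next scale uses up the budget `2 ^ j` between `8 / walshMax f - 2 ^ j` and `8 /
    -- walshMax f - 2 ^ (j + 1)`. Since `8 / walshMax f ≥ 4 * 2 ^ j`, enough is left for a
    -- refinement at the current scale.
    have hqU : q ≤ U * Z * 2 ^ j := by
      calc q ≤ 4096 * (3 * m + 10) * 2 ^ j * 2 ^ j * (j + 5 + (s + j + 2 : ℕ)) :=
            testCost_le (by omega)
        _ ≤ 4096 * (3 * m + 10) * 2 ^ m * 2 ^ j * Z := by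
          gcongr
          push_cast
          linarith
        _ = U * Z * 2 ^ j := by
          rw [hU]
          ring
    have hZ0 : 0 ≤ Z := le_trans (by positivity) hZj
    have hUZ : 0 ≤ U * Z := mul_nonneg hU0 hZ0
    have hv0 : 0 ≤ w * (1 - a - a * (b / 2)) := by
      refine mul_nonneg hw0 ?_
      have : a * (b / 2) = a * b / 2 := by ring
      linarith
    have hPf := hP f (w * (1 - a - a * (b / 2))) B hv0 (fun h => by linarith) (fun h => ?_)
      (fun h => ?_)
    · refine hPf.mono ?_ le_rfl
      rw [mul_assoc]
      refine mul_le_mul_of_nonneg_left ?_ hw0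
      nlinarith [mul_nonneg ha0 hab0, mul_nonneg hab0 hab0]
    · refine (hP₁ f _ (by linarith) (abs_le.2 ⟨by linarith, by linarith⟩) le_rfl).mono ?_ ?_
      · refine mul_le_mul_of_nonneg_left ?_ hw0
        have h₁ : 0 ≤ a * (1 / 2 ^ (d + 1)) := by positivity
        have h₂ : 0 ≤ a * (b / 2) := by positivity
        linarith
      · have h₁ : 2 * (4096 * (3 * m + 10) * 2 ^ j) *
            (2 ^ m * (j + s + 9) - 2 ^ j * (j + s + 9 + (d + 1 : ℕ))) ≤ 2 * (U * Z * 2 ^ j) := by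
          calc _ ≤ 2 * (4096 * (3 * m + 10) * 2 ^ j) * (2 ^ m * Z) := by
                have h₂ : (j : ℝ) + s + 9 ≤ Z := by
                  have : (0 : ℝ) ≤ j := Nat.cast_nonneg j
                  linarith
                gcongr
                have h₃ : (2 : ℝ) ^ m * (j + s + 9) ≤ 2 ^ m * Z := by gcongr
                have h₄ : (0 : ℝ) ≤ 2 ^ j * (j + s + 9 + (d + 1 : ℕ)) := by positivity
                linarith
            _ = _ := by
              rw [hU]
              ring
        have h₃ : U * Z * (4 * 2 ^ j) ≤ U * Z * (8 / walshMax f) := by gcongr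
        linarith
    · refine (hP₀ f _ Z hZ ?_ le_rfl).mono le_rfl ?_
      · have h₁ : walshMax f ≤ 1 / 2 ^ j := by linarith
        rw [le_div_iff₀ (by positivity)] at h₁
        rw [pow_succ]
        linarith
      · rw [pow_succ]
        linarith

/-- The algorithm, with dyadic parameters. -/
theorem exists_algorithm (n m s t : ℕ) {lam : ℝ} (hlam : 1 / 2 ^ (m + t + 1) ≤ lam) :
    ∃ A : QueryAlgorithm n, ∀ f (B Z : ℝ),
      (∀ k : ℕ, 2 ^ k * walshMax f ≤ 2 → 2 * k + 9 + s ≤ Z) →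
      4096 * (3 * m + 10) * 2 ^ m * Z * (8 / walshMax f) ≤ B →
      1 / 2 ^ t * (1 - 1 / 2 ^ s) ≤
        A.prob f {p : ℝ × ℕ | |nonlinearity f - p.1| ≤ lam ∧ (p.2 : ℝ) ≤ B} := by
  -- One register size that is large enough for every test of the search and for the guess.
  set N := (3 * m + 10) * 2 ^ (m + 4) + (2 * m + s + 8) * 2 ^ (m + 5) + 2 ^ t with hN
  have : NeZero N := ⟨by positivity⟩
  obtain ⟨P, hP⟩ := exists_locate n (N := N) (lam := lam) (m := m) (s := s) (t := t)
    (fun i hi => by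
      calc (3 * i + 10) * 2 ^ (i + 4) ≤ (3 * m + 10) * 2 ^ (m + 4) := by
            gcongr
            norm_num
        _ ≤ N := by
          rw [hN, add_assoc]
          exact Nat.le_add_right _ _)
    (fun j hj s' hs' => by
      calc (j + 5 + s') * 2 ^ (j + 5) ≤ (2 * m + s + 8) * 2 ^ (m + 5) :=
            Nat.mul_le_mul (by omega) (Nat.pow_le_pow_right two_pos (by omega))
        _ ≤ N := by
          rw [hN]
          exact (Nat.le_add_left _ _).trans (Nat.le_add_right _ _))
    (Nat.le_add_left _ _) hlam m 0 (by omega)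
  refine ⟨⟨TestSpace n N, ((fun _ => false, 0), 0), P⟩, fun f B Z hZ hB => ?_⟩
  have hc := walshMax_le_one f
  have hZ0 : 0 ≤ Z := le_trans (by positivity) (hZ 0 (by linarith))
  have := hP f B Z hZ (by linarith) (by
    refine le_trans ?_ hB
    gcongr
    simp)
  refine le_trans (le_of_eq ?_) this
  rw [pow_succ]
  field_simp
  ring

/-- Guessing without queries. -/
theorem exists_guess_algorithm (n m t : ℕ) {lam : ℝ} (hlam : 1 / 2 ^ (m + t + 1) ≤ lam) {e : ℝ}
    (he : ∀ f : BitString n → Bool, |walshMax f - e| ≤ 1 / 2 ^ m) :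
    ∃ A : QueryAlgorithm n, ∀ f (B : ℝ), 0 ≤ B → 1 / 2 ^ t ≤
      A.prob f {p : ℝ × ℕ | |nonlinearity f - p.1| ≤ lam ∧ (p.2 : ℝ) ≤ B} := by
  have : NeZero (2 ^ t) := ⟨by positivity⟩
  obtain ⟨P, hP⟩ := exists_guess n (N := 2 ^ t) lam le_rfl hlam e
  exact ⟨⟨TestSpace n (2 ^ t), ((fun _ => false, 0), 0), P⟩, fun f B hB => hP f B hB (he f)⟩

end Search

/-! ### Choice of the parameters -/

section Main

/-- A dyadic approximation from below of a number in `(0, 1]`. -/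
theorem exists_two_pow_near {x : ℝ} (h₀ : 0 < x) (h₁ : x ≤ 1) :
    ∃ k : ℕ, 1 / 2 ^ (k + 1) < x ∧ x ≤ 1 / 2 ^ k ∧ (k : ℝ) ≤ 2 * Real.log (1 / x) := by
  obtain ⟨k, hk₁, hk₂⟩ := exists_nat_pow_near_of_lt_one h₀ h₁ (y := 1 / 2) (by norm_num)
    (by norm_num)
  rw [one_div_pow] at hk₁ hk₂
  refine ⟨k, hk₁, hk₂, ?_⟩
  have h : Real.log (2 ^ k) ≤ Real.log (1 / x) := by
    refine Real.log_le_log (by positivity) ?_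
    rw [le_div_iff₀ h₀]
    rwa [le_div_iff₀ (by positivity), mul_comm] at hk₂
  rw [Real.log_pow] at h
  have h2 := Real.log_two_gt_d9
  have hk : (0 : ℝ) ≤ k := Nat.cast_nonneg k
  nlinarith

/-- The hypothesis is the invariant of the search at scale `k`; the bound turns the scale into the
logarithm of `1 / walshMax f`. -/
theorem two_pow_mul_le_two {c : ℝ} (hc : 0 < c) (hc₁ : c ≤ 1) {k : ℕ} (hk : 2 ^ k * c ≤ 2) :
    (k : ℝ) ≤ 1 + 2 * Real.log (1 / c) := by
  have h : Real.log (2 ^ k) ≤ Real.log (2 * (1 / c)) := by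
    refine Real.log_le_log (by positivity) ?_
    rw [mul_one_div, le_div_iff₀ hc]
    exact hk
  rw [Real.log_pow, Real.log_mul two_ne_zero (by positivity)] at h
  have h2 := Real.log_two_gt_d9
  rcases Nat.eq_zero_or_pos k with rfl | hpos
  · have : 0 ≤ Real.log (1 / c) := Real.log_nonneg (by rwa [le_div_iff₀ hc, one_mul])
    rw [Nat.cast_zero]
    linarith
  · have hk1 : (0 : ℝ) ≤ (k : ℝ) - 1 := by
      rw [sub_nonneg]
      exact_mod_cast hpos
    nlinarith

theorem mainTheorem8 :
    ∃ C : ℝ, 0 < C ∧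
      ∀ (n : ℕ) (lam δ : ℝ), 0 < lam → lam < 1 → 0 < δ → δ < 1 →
        ∃ A : QueryAlgorithm n, ∀ f : BitString n → Bool,
          1 - δ ≤ A.prob f
            {p : ℝ × ℕ | |nonlinearity f - p.1| ≤ lam ∧
              (p.2 : ℝ) ≤ C * ((1 / (lam * walshMax f)) * Real.log (1 / lam) *
                Real.log (1 / (δ * walshMax f)))} := by
  refine ⟨10 ^ 8, by norm_num, fun n lam δ hlam₀ hlam₁ hδ₀ hδ₁ => ?_⟩
  have hlog : 0 ≤ Real.log (1 / lam) := Real.log_nonneg (by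
    rw [le_div_iff₀ hlam₀]
    linarith)
  have hlogc : ∀ f : BitString n → Bool, 0 ≤ Real.log (1 / walshMax f) := fun f =>
    Real.log_nonneg (by
      rw [le_div_iff₀ (walshMax_pos f), one_mul]
      exact walshMax_le_one f)
  have hlogδ : 0 ≤ Real.log (1 / δ) := Real.log_nonneg (by
    rw [le_div_iff₀ hδ₀]
    linarith)
  have hsplit : ∀ f : BitString n → Bool, Real.log (1 / (δ * walshMax f)) =
      Real.log (1 / δ) + Real.log (1 / walshMax f) := by
    intro f
    have := walshMax_pos f
    rw [← Real.log_mul (by positivity) (by positivity), div_mul_div_comm, one_mul]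
  have hB₀ : ∀ f : BitString n → Bool, 0 ≤ 10 ^ 8 * ((1 / (lam * walshMax f)) *
      Real.log (1 / lam) * Real.log (1 / (δ * walshMax f))) := by
    intro f
    rw [hsplit]
    have h₁ := walshMax_pos f
    have h₂ := hlogc f
    positivity
  -- The non-linearity lies in `[0, 1/2]`, so the constant `1/4` has error at most `1/4`. For
  -- smaller `lam` the logarithm is bounded below and absorbs additive constants.
  rcases le_or_gt (1 / 4) lam with hlam | hlam
  · obtain ⟨A, hA⟩ := exists_guess_algorithm n 1 0 (lam := lam) (e := 1 / 2) (by
      norm_num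
      linarith) (fun f => by
        have h₁ := walshMax_pos f
        have h₂ := walshMax_le_one f
        rw [abs_le]
        constructor <;> linarith)
    refine ⟨A, fun f => le_trans ?_ (hA f _ (hB₀ f))⟩
    norm_num
    linarith
  obtain ⟨k, hk₁, hk₂, hk₃⟩ := exists_two_pow_near hlam₀ hlam₁.le
  have hk2 : 2 ≤ k := by
    by_contra hlt
    have h₁ : k + 1 ≤ 2 := by omega
    have h₂ : (1 : ℝ) / 2 ^ 2 ≤ 1 / 2 ^ (k + 1) :=
      one_div_le_one_div_of_le (by positivity) (pow_le_pow_right₀ one_le_two h₁)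
    have h₃ : (1 : ℝ) / 2 ^ 2 = 1 / 4 := by norm_num
    linarith
  have hklog : (3 : ℝ) * (k + 1 : ℕ) + 10 ≤ 20 * Real.log (1 / lam) := by
    have : (2 : ℝ) ≤ k := by exact_mod_cast hk2
    push_cast
    linarith
  have hkpow : (2 : ℝ) ^ (k + 1) ≤ 2 / lam := by
    rw [le_div_iff₀ (by positivity)] at hk₂
    rw [le_div_iff₀ hlam₀, pow_succ]
    linarith
  -- For `δ ≤ 1/2` the logarithm of `1 / δ` is bounded below, and the search runs to full precision
  -- with `t = 0`, without guessing.
  rcases le_or_gt δ (1 / 2) with hδ | hδ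
  · obtain ⟨s, hs₁, -, hs₃⟩ := exists_two_pow_near hδ₀ hδ₁.le
    obtain ⟨A, hA⟩ := exists_algorithm n (k + 1) (s + 1) 0 (lam := lam) (by
      refine le_trans (one_div_le_one_div_of_le (by positivity) ?_) hk₁.le
      exact pow_le_pow_right₀ one_le_two (by omega))
    refine ⟨A, fun f => ?_⟩
    have hc := walshMax_pos f
    have hcl := hlogc f
    have hlδ : 1 / 2 ≤ Real.log (1 / δ) := by
      have h₁ : (2 : ℝ) ≤ 1 / δ := by
        rw [le_div_iff₀ hδ₀]
        linarith
      have h₂ := Real.log_le_log two_pos h₁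
      have h₃ := Real.log_two_gt_d9
      linarith
    have key := hA f (10 ^ 8 * ((1 / (lam * walshMax f)) * Real.log (1 / lam) *
      Real.log (1 / (δ * walshMax f)))) (28 * Real.log (1 / (δ * walshMax f)))
      (fun j hj => by
        have h₁ := two_pow_mul_le_two hc (walshMax_le_one f) hj
        rw [hsplit]
        push_cast
        linarith)
      (by
        have hL : 0 ≤ Real.log (1 / (δ * walshMax f)) := by
          rw [hsplit]
          positivity
        calc 4096 * (3 * (k + 1 : ℕ) + 10) * 2 ^ (k + 1) *
              (28 * Real.log (1 / (δ * walshMax f))) * (8 / walshMax f) ≤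
              4096 * (20 * Real.log (1 / lam)) * (2 / lam) *
              (28 * Real.log (1 / (δ * walshMax f))) * (8 / walshMax f) := by gcongr
          _ = (4096 * 20 * 2 * 28 * 8) * ((1 / (lam * walshMax f)) * Real.log (1 / lam) *
              Real.log (1 / (δ * walshMax f))) := by
            field_simp
          _ ≤ _ := by
            gcongr
            norm_num)
    refine le_trans ?_ key
    rw [pow_zero, div_one, one_mul]
    linarith
  · set γ := 1 - δ with hγ
    have hγ₀ : 0 < γ := by linarith
    have hγ₁ : 2 * γ ≤ 1 := by linarith
    obtain ⟨t, ht₁, ht₂, -⟩ := exists_two_pow_near (by positivity : 0 < 2 * γ) hγ₁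
    -- If the required success probability is below that of guessing all `k + 1` bits, no query is
    -- made. Otherwise `t` bits are guessed and `m = k + 1 - t` are computed.
    rcases le_or_gt (k + 1) t with htk | htk
    · obtain ⟨A, hA⟩ := exists_guess_algorithm n 0 (k + 1) (lam := lam) (e := 0) (by
        refine le_trans (one_div_le_one_div_of_le (by positivity) ?_) hk₁.le
        exact pow_le_pow_right₀ one_le_two (by omega)) (fun f => by
          rw [sub_zero, abs_of_pos (walshMax_pos f), pow_zero, div_one]
          exact walshMax_le_one f)
      refine ⟨A, fun f => le_trans ?_ (hA f _ (hB₀ f))⟩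
      have h₁ : (1 : ℝ) / 2 ^ t ≤ 1 / 2 ^ (k + 1) :=
        one_div_le_one_div_of_le (by positivity) (pow_le_pow_right₀ one_le_two htk)
      linarith
    · obtain ⟨m, hm⟩ := Nat.exists_eq_add_of_le htk.le
      obtain ⟨A, hA⟩ := exists_algorithm n m 1 t (lam := lam) (by
        refine le_trans (one_div_le_one_div_of_le (by positivity) ?_) hk₁.le
        exact pow_le_pow_right₀ one_le_two (by omega))
      refine ⟨A, fun f => ?_⟩
      have hc := walshMax_pos f
      have hcl := hlogc f
      -- Guessing shrinks `2 ^ m` by a factor of order `γ`, and this inequality trades that factor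
      -- for the logarithm of `1 / δ`.
      have hlγ : γ ≤ Real.log (1 / δ) := by
        rw [one_div, Real.log_inv]
        have := Real.log_le_sub_one_of_pos hδ₀
        linarith
      have hmpow : (2 : ℝ) ^ m ≤ 2 / lam * (4 * γ) := by
        rw [hm, pow_add] at hkpow
        rw [div_lt_iff₀ (by positivity), pow_succ] at ht₁
        calc (2 : ℝ) ^ m = 2 ^ m * 1 := (mul_one _).symm
          _ ≤ 2 ^ m * (2 * γ * (2 ^ t * 2)) := by gcongr
          _ = 2 ^ t * 2 ^ m * (4 * γ) := by ring
          _ ≤ 2 / lam * (4 * γ) := by gcongr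
      have hmlog : (3 : ℝ) * m + 10 ≤ 20 * Real.log (1 / lam) := by
        refine le_trans ?_ hklog
        have : (m : ℝ) ≤ (k + 1 : ℕ) := by
          exact_mod_cast (by omega : m ≤ k + 1)
        linarith
      have hγZ : γ * (12 + 4 * Real.log (1 / walshMax f)) ≤
          12 * Real.log (1 / (δ * walshMax f)) := by
        rw [hsplit]
        have : γ * Real.log (1 / walshMax f) ≤ Real.log (1 / walshMax f) :=
          mul_le_of_le_one_left hcl (by linarith)
        linarith
      have key := hA f (10 ^ 8 * ((1 / (lam * walshMax f)) * Real.log (1 / lam) *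
        Real.log (1 / (δ * walshMax f)))) (12 + 4 * Real.log (1 / walshMax f))
        (fun j hj => by
          have h₁ := two_pow_mul_le_two hc (walshMax_le_one f) hj
          push_cast
          linarith)
        (by
          have hL : 0 ≤ Real.log (1 / (δ * walshMax f)) := by
            rw [hsplit]
            positivity
          calc 4096 * (3 * (m : ℝ) + 10) * 2 ^ m *
                (12 + 4 * Real.log (1 / walshMax f)) * (8 / walshMax f) ≤
                4096 * (20 * Real.log (1 / lam)) * (2 / lam * (4 * γ)) *
                (12 + 4 * Real.log (1 / walshMax f)) * (8 / walshMax f) := by gcongr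
            _ = 4096 * (20 * Real.log (1 / lam)) * (2 / lam * 4) *
                (γ * (12 + 4 * Real.log (1 / walshMax f))) * (8 / walshMax f) := by ring
            _ ≤ 4096 * (20 * Real.log (1 / lam)) * (2 / lam * 4) *
                (12 * Real.log (1 / (δ * walshMax f))) * (8 / walshMax f) := by gcongr
            _ = (4096 * 20 * 2 * 4 * 12 * 8) * ((1 / (lam * walshMax f)) * Real.log (1 / lam) *
                Real.log (1 / (δ * walshMax f))) := by
              field_simp
            _ ≤ _ := by
              gcongr
              norm_num)
      refine le_trans ?_ key
      rw [pow_one]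
      linarith

end Main
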